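/- Let $\mu_1(\cdot;t),\mu_2(\cdot;t)$, $t\in U$ ($U\subseteq\mathbb R$ open), be non-negative Borel measures on $\mathbb R_+=[0,\infty)$ (not both with an atom at $0$), neither concentrated on finitely many points, such that for all $t\in U$ and all integers $i,j\ge 0$ the moments $$m_{i,j}=\iint\frac{x^iy^j}{x+y}\,d\mu_1(x;t)\,d\mu_2(y;t),\qquad \hat\phi_i=\int x^i\,d\mu_1(x;t),\qquad \phi_j=\int y^j\,d\mu_2(y;t)$$ converge absolutely. Assume that $\partial_t\,d\mu_1(x;t)=x\,d\mu_1(x;t)$ and $\partial_t\,d\mu_2(y;t)=y\,d\mu_2(y;t)$ on $U$, i.e. $\frac{d}{dt}\mu_i(E;t)=\int_E x\,d\mu_i(x;t)$ for every bounded Borel set $E$ and $i=1,2$. Put $\Delta_n(z)=\prod_{1\le j<k\le n}(z_k-z_j)$ and, for $n\ge 0$, $$\tau_n=\frac1{(n!)^2}\int_{\mathbb R_+^n\times\mathbb R_+^n}\frac{\Delta_n^2(x)\Delta_n^2(y)}{\prod_{j,k=1}^n(x_j+y_k)}\prod_{j=1}^n d\mu_1(x_j;t)\,d\mu_2(y_j;t),$$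 $$\hat\sigma_n=\frac1{n!(n+1)!}\int_{\mathbb R_+^{n+1}\times\mathbb R_+^n}\frac{\Delta_{n+1}^2(x)\Delta_n^2(y)}{\prod_{j=1}^{n+1}\prod_{k=1}^n(x_j+y_k)}\prod_{j=1}^{n+1}d\mu_1(x_j;t)\prod_{k=1}^n d\mu_2(y_k;t),$$ $$\sigma_n=\frac1{n!(n+1)!}\int_{\mathbb R_+^{n}\times\mathbb R_+^{n+1}}\frac{\Delta_{n}^2(x)\Delta_{n+1}^2(y)}{\prod_{j=1}^{n}\prod_{k=1}^{n+1}(x_j+y_k)}\prod_{j=1}^{n}d\mu_1(x_j;t)\prod_{k=1}^{n+1} d\mu_2(y_k;t),$$ and let $\hat\xi_n$ and $\xi_n$ be given by the integral for $\tau_n$ with the additional factor $\sum_{j=1}^n y_j$, respectively $\sum_{j=1}^n x_j$, in the integrand (so $\xi_0=\hat\xi_0=0$). Then, for all $t\in U$ and $n\ge0$: (1) All these integrals converge absolutely; $\tau_n,\sigma_n,\hat\sigma_n>0$; and $$\tau_n=\det(m_{i,j})_{i,j=0}^{n-1},\quad \sigma_n=\det\begin{pmatrix}m_{i,j}\\ \phi_j\end{pmatrix}_{\substack{i=0,\dots,n-1\\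 j=0,\dots,n}},\quad \hat\sigma_n=\det\begin{pmatrix}m_{i,j}&\hat\phi_i\end{pmatrix}_{\substack{i=0,\dots,n\\ j=0,\dots,n-1}},$$ and for $n\ge1$ $$\xi_n=\det(m_{i,j})_{\substack{i=0,\dots,n-2,n\\ j=0,\dots,n-1}},\qquad \hat\xi_n=\det(m_{i,j})_{\substack{i=0,\dots,n-1\\ j=0,\dots,n-2,n}}.$$ (2) With $\tau_{-1}=0$, the functions $$A_n=\frac{\tau_{n+1}\tau_{n-1}}{\tau_n^2},\quad B_n=\frac{\xi_{n+1}}{\tau_{n+1}}-\frac{\xi_n}{\tau_n},\quad \hat B_n=\frac{\hat\xi_{n+1}}{\tau_{n+1}}-\frac{\hat\xi_n}{\tau_n},\quad C_n=-\frac{\sigma_{n+1}\tau_n}{\sigma_n\tau_{n+1}},\quad \hat C_n=-\frac{\hat\sigma_{n+1}\tau_n}{\hat\sigma_n\tau_{n+1}}$$ are differentiable on $U$, $C_n$ and $\hat C_n$ do not vanish, and they satisfy \begin{align*} \partial_tA_n&=A_n(B_n+\hat B_n-B_{n-1}-\hat B_{n-1}),\\ \partial_tB_n&=(B_{n-1}+\hat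 B_{n-1})\hat C_{n-1}-(B_n+\hat B_n)\hat C_n,\\ \partial_t\hat B_n&=(B_{n-1}+\hat B_{n-1})C_{n-1}-(B_n+\hat B_n)C_n,\\ \partial_tC_n&=C_n\Big(C_n-\frac{A_n}{C_{n-1}}-\hat B_n-C_{n+1}+\frac{A_{n+1}}{C_n}+\hat B_{n+1}\Big),\\ \partial_t\hat C_n&=\hat C_n\Big(\hat C_n-\frac{A_n}{\hat C_{n-1}}-B_n-\hat C_{n+1}+\frac{A_{n+1}}{\hat C_n}+B_{n+1}\Big), \end{align*} where for $n=0$ one has $A_0=0$ and all terms with index $-1$ are omitted. -/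

import Mathlib

open MeasureTheory

namespace CauchyTwoMatrix

noncomputable section

/-- The evolution `∂ₜ dμ(x;t) = x dμ(x;t)` for `t ∈ U`, read on every bounded Borel set `E`:
`d/dt μ(E;t) = ∫_E x dμ(x;t)`. -/
def EvolvesByPosition (μ : ℝ → Measure ℝ) (U : Set ℝ) : Prop :=
  ∀ t ∈ U, ∀ E : Set ℝ, MeasurableSet E → Bornology.IsBounded E →
    HasDerivAt (fun s => (μ s).real E) (∫ x in E, x ∂(μ t)) t

/-- A pair of measures on the half-line (not both with an atom at the origin, where the kernel
`1 / (x + y)` is infinite), neither of them concentrated on finitely many points, all of whose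
single moments and Cauchy moments are finite. -/
structure AdmissiblePair (μ₁ μ₂ : Measure ℝ) : Prop where
  nonneg₁ : μ₁ (Set.Iio 0) = 0
  nonneg₂ : μ₂ (Set.Iio 0) = 0
  origin : μ₁ {0} = 0 ∨ μ₂ {0} = 0
  infinite₁ : ∀ S : Set ℝ, S.Finite → μ₁ Sᶜ ≠ 0
  infinite₂ : ∀ S : Set ℝ, S.Finite → μ₂ Sᶜ ≠ 0
  moment₁ : ∀ k : ℕ, Integrable (fun x : ℝ => x ^ k) μ₁
  moment₂ : ∀ k : ℕ, Integrable (fun y : ℝ => y ^ k) μ₂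
  cauchyMoment : ∀ i j : ℕ,
    Integrable (fun p : ℝ × ℝ => p.1 ^ i * p.2 ^ j / (p.1 + p.2)) (μ₁.prod μ₂)

/-- `m i j = ∬ xⁱ yʲ / (x + y) dμ₁(x) dμ₂(y)`. -/
def moment (μ₁ μ₂ : Measure ℝ) (i j : ℕ) : ℝ :=
  ∫ p : ℝ × ℝ, p.1 ^ i * p.2 ^ j / (p.1 + p.2) ∂(μ₁.prod μ₂)

/-- `∫ xʲ dμ(x)`. -/
def singleMoment (μ : Measure ℝ) (j : ℕ) : ℝ := ∫ x, x ^ j ∂μ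

/-- `Δₙ(z) = ∏_{j<k} (z_k - z_j)`. -/
def vandermondeProd {n : ℕ} (z : Fin n → ℝ) : ℝ :=
  ∏ j : Fin n, ∏ k ∈ Finset.Ioi j, (z k - z j)

/-- `Δ_p(x)² Δ_q(y)² / ∏_{j,k} (x_j + y_k)`. -/
def density (p q : ℕ) (z : (Fin p → ℝ) × (Fin q → ℝ)) : ℝ :=
  vandermondeProd z.1 ^ 2 * vandermondeProd z.2 ^ 2 /
    ∏ j : Fin p, ∏ k : Fin q, (z.1 j + z.2 k)

/-- The measure `∏_j dμ₁(x_j) ∏_k dμ₂(y_k)`. -/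
def productMeasure (μ₁ μ₂ : Measure ℝ) (p q : ℕ) : Measure ((Fin p → ℝ) × (Fin q → ℝ)) :=
  (Measure.pi fun _ : Fin p => μ₁).prod (Measure.pi fun _ : Fin q => μ₂)

def tau (μ₁ μ₂ : Measure ℝ) (n : ℕ) : ℝ :=
  1 / (n.factorial : ℝ) ^ 2 * ∫ z, density n n z ∂(productMeasure μ₁ μ₂ n n)

def sigmaHat (μ₁ μ₂ : Measure ℝ) (n : ℕ) : ℝ :=
  1 / ((n.factorial : ℝ) * ((n + 1).factorial : ℝ)) *
    ∫ z, density (n + 1) n z ∂(productMeasure μ₁ μ₂ (n + 1) n)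

def sigma (μ₁ μ₂ : Measure ℝ) (n : ℕ) : ℝ :=
  1 / ((n.factorial : ℝ) * ((n + 1).factorial : ℝ)) *
    ∫ z, density n (n + 1) z ∂(productMeasure μ₁ μ₂ n (n + 1))

def xiHat (μ₁ μ₂ : Measure ℝ) (n : ℕ) : ℝ :=
  1 / (n.factorial : ℝ) ^ 2 *
    ∫ z, density n n z * ∑ j, z.2 j ∂(productMeasure μ₁ μ₂ n n)

def xi (μ₁ μ₂ : Measure ℝ) (n : ℕ) : ℝ :=
  1 / (n.factorial : ℝ) ^ 2 *
    ∫ z, density n n z * ∑ j, z.1 j ∂(productMeasure μ₁ μ₂ n n)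

/-- The integrals defining the five tau functions converge absolutely. -/
structure TauIntegrable (μ₁ μ₂ : Measure ℝ) (n : ℕ) : Prop where
  tau : Integrable (density n n) (productMeasure μ₁ μ₂ n n)
  sigmaHat : Integrable (density (n + 1) n) (productMeasure μ₁ μ₂ (n + 1) n)
  sigma : Integrable (density n (n + 1)) (productMeasure μ₁ μ₂ n (n + 1))
  xiHat : Integrable (fun z => density n n z * ∑ j, z.2 j) (productMeasure μ₁ μ₂ n n)
  xi : Integrable (fun z => density n n z * ∑ j, z.1 j) (productMeasure μ₁ μ₂ n n)

/-- The enumeration `0, …, n - 2, n` of `n` indices. -/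
def skipIndex (n : ℕ) (i : Fin n) : ℕ := if (i : ℕ) + 1 = n then n else i

/-- The Gram-type determinant formulas for the tau functions.  The index lists of `xi` and `xiHat`
make sense for `n ≥ 1` only; the integrals for `n = 0` have an empty sum as a factor. -/
structure TauDeterminants (μ₁ μ₂ : Measure ℝ) (n : ℕ) : Prop where
  tau : tau μ₁ μ₂ n = (Matrix.of fun i j : Fin n => moment μ₁ μ₂ i j).det
  sigma : sigma μ₁ μ₂ n = (Matrix.of fun i j : Fin (n + 1) =>
    if (i : ℕ) < n then moment μ₁ μ₂ i j else singleMoment μ₂ j).det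
  sigmaHat : sigmaHat μ₁ μ₂ n = (Matrix.of fun i j : Fin (n + 1) =>
    if (j : ℕ) < n then moment μ₁ μ₂ i j else singleMoment μ₁ i).det
  xi : 1 ≤ n → xi μ₁ μ₂ n = (Matrix.of fun i j : Fin n => moment μ₁ μ₂ (skipIndex n i) j).det
  xiHat : 1 ≤ n →
    xiHat μ₁ μ₂ n = (Matrix.of fun i j : Fin n => moment μ₁ μ₂ i (skipIndex n j)).det
  xi_zero : CauchyTwoMatrix.xi μ₁ μ₂ 0 = 0
  xiHat_zero : CauchyTwoMatrix.xiHat μ₁ μ₂ 0 = 0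

/-- `Aₙ = τₙ₊₁ τₙ₋₁ / τₙ²`, with `τ₋₁ = 0`. -/
def A (μ₁ μ₂ : Measure ℝ) : ℕ → ℝ
  | 0 => 0
  | n + 1 => tau μ₁ μ₂ (n + 2) * tau μ₁ μ₂ n / tau μ₁ μ₂ (n + 1) ^ 2

def B (μ₁ μ₂ : Measure ℝ) (n : ℕ) : ℝ :=
  xi μ₁ μ₂ (n + 1) / tau μ₁ μ₂ (n + 1) - xi μ₁ μ₂ n / tau μ₁ μ₂ n

def BHat (μ₁ μ₂ : Measure ℝ) (n : ℕ) : ℝ :=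
  xiHat μ₁ μ₂ (n + 1) / tau μ₁ μ₂ (n + 1) - xiHat μ₁ μ₂ n / tau μ₁ μ₂ n

def C (μ₁ μ₂ : Measure ℝ) (n : ℕ) : ℝ :=
  -(sigma μ₁ μ₂ (n + 1) * tau μ₁ μ₂ n / (sigma μ₁ μ₂ n * tau μ₁ μ₂ (n + 1)))

def CHat (μ₁ μ₂ : Measure ℝ) (n : ℕ) : ℝ :=
  -(sigmaHat μ₁ μ₂ (n + 1) * tau μ₁ μ₂ n / (sigmaHat μ₁ μ₂ n * tau μ₁ μ₂ (n + 1)))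

/-- The semi-infinite nonlinear lattice at the times `t ∈ U`.  The fields ending in `_succ` are the
equations at the sites `n + 1 ≥ 1`; those ending in `_zero` are the equations at the boundary site
`0`, where the terms with index `-1` (all of which carry a factor `A₀ = 0` or `B₋₁ + B̂₋₁ = 0`)
are absent. -/
structure IsLatticeSolution (U : Set ℝ) (A B B' C C' : ℕ → ℝ → ℝ) : Prop where
  C_ne_zero : ∀ t ∈ U, ∀ n, C n t ≠ 0
  C'_ne_zero : ∀ t ∈ U, ∀ n, C' n t ≠ 0
  A_zero : ∀ t ∈ U, A 0 t = 0
  A_succ : ∀ t ∈ U, ∀ n, HasDerivAt (A (n + 1))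
    (A (n + 1) t * (B (n + 1) t + B' (n + 1) t - B n t - B' n t)) t
  B_zero : ∀ t ∈ U, HasDerivAt (B 0) (-((B 0 t + B' 0 t) * C' 0 t)) t
  B_succ : ∀ t ∈ U, ∀ n, HasDerivAt (B (n + 1))
    ((B n t + B' n t) * C' n t - (B (n + 1) t + B' (n + 1) t) * C' (n + 1) t) t
  B'_zero : ∀ t ∈ U, HasDerivAt (B' 0) (-((B 0 t + B' 0 t) * C 0 t)) t
  B'_succ : ∀ t ∈ U, ∀ n, HasDerivAt (B' (n + 1))
    ((B n t + B' n t) * C n t - (B (n + 1) t + B' (n + 1) t) * C (n + 1) t) t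
  C_zero : ∀ t ∈ U, HasDerivAt (C 0)
    (C 0 t * (C 0 t - B' 0 t - C 1 t + A 1 t / C 0 t + B' 1 t)) t
  C_succ : ∀ t ∈ U, ∀ n, HasDerivAt (C (n + 1))
    (C (n + 1) t * (C (n + 1) t - A (n + 1) t / C n t - B' (n + 1) t
      - C (n + 2) t + A (n + 2) t / C (n + 1) t + B' (n + 2) t)) t
  C'_zero : ∀ t ∈ U, HasDerivAt (C' 0)
    (C' 0 t * (C' 0 t - B 0 t - C' 1 t + A 1 t / C' 0 t + B 1 t)) t
  C'_succ : ∀ t ∈ U, ∀ n, HasDerivAt (C' (n + 1))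
    (C' (n + 1) t * (C' (n + 1) t - A (n + 1) t / C' n t - B (n + 1) t
      - C' (n + 2) t + A (n + 2) t / C' (n + 1) t + B (n + 2) t)) t

end

end CauchyTwoMatrix

/-! Everything rests on the moments. Multiplying the kernel `1 / (x + y)` by `x + y` gives the
relation m(i+1,j) + m(i,j+1) = φ̂ᵢ φⱼ (`moment_add`). The evolution law forces μ(t) = e^{(t-s)x}
μ(s) (`eq_withDensity`), so ∂m(i,j) is the same rank one array φ̂ᵢ φⱼ and ∂φⱼ = φⱼ₊₁
(`hasDerivAt_moment`, `hasDerivAt_singleMoment₁`).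

The integrals become determinants: the Cauchy determinant writes each density as a product of three
determinants (`det_cauchy`, `det_cauchy_snoc_one`), and an Andréief expansion integrates that
product to a determinant of moments (`integral_det_mul_det_mul_det`). Positivity is read off the
integrals, since the density is nonnegative almost everywhere and nonzero on a set of positive
measure.

All these determinants are minors of one array: m bordered by the column φ̂, the row φ and a corner
0. A rank one evolution differentiates a minor to minus its bordered minor (`hasDerivAt_minor`).
Because the rank one direction is also a row shift plus a column shift, τ' = ξ + ξ̂, and σ' is a sum
of two shifted minors. The Desnanot–Jacobi identity then yields the bilinear relations collected in
`TauFlow`. Logarithmic derivatives turn these into the lattice equations; exchanging x and y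
supplies the hatted half. -/

namespace CauchyTwoMatrix

/-! ### Bordered minors and derivatives of determinants. -/

open Matrix

/-- The determinant of the square array with row labels `ρ` and column labels `κ`. -/
noncomputable def minor {α β : Type*} {n : ℕ} (E : α → β → ℝ) (ρ : Fin n → α) (κ : Fin n → β) : ℝ :=
  (Matrix.of fun i j => E (ρ i) (κ j)).det

variable {α β : Type*} {n : ℕ} (E : α → β → ℝ) (ρ : Fin n → α) (κ : Fin n → β)

lemma minor_swap : minor (fun b a => E a b) κ ρ = minor E ρ κ := by
  rw [minor, minor, ← det_transpose]
  rfl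

/-- Schur complement of the invertible block with labels `ρ`, `κ`. -/
lemma minor_append {r : ℕ} (b : Fin r → α) (a : Fin r → β) (h : minor E ρ κ ≠ 0) :
    minor E (Fin.append ρ b) (Fin.append κ a) = minor E ρ κ *
      (Matrix.of fun i j => E (b i) (a j) - ((fun l => E (b i) (κ l)) ᵥ*
        (Matrix.of fun i j => E (ρ i) (κ j))⁻¹) ⬝ᵥ fun k => E (ρ k) (a j)).det := by
  set M : Matrix (Fin n) (Fin n) ℝ := Matrix.of fun i j => E (ρ i) (κ j) with hM
  have hu : IsUnit M.det := isUnit_iff_ne_zero.2 h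
  let _ := M.invertibleOfIsUnitDet hu
  have h1 : minor E (Fin.append ρ b) (Fin.append κ a) =
      (Matrix.fromBlocks M (Matrix.of fun i j => E (ρ i) (a j))
        (Matrix.of fun i j => E (b i) (κ j)) (Matrix.of fun i j => E (b i) (a j))).det := by
    rw [minor, ← det_submatrix_equiv_self finSumFinEquiv]
    congr 1
    ext i j
    rcases i with i | i <;> rcases j with j | j <;> simp [M]
  rw [h1, det_fromBlocks₁₁, invOf_eq_nonsing_inv]
  congr 2

lemma minor_snoc (b : α) (a : β) (h : minor E ρ κ ≠ 0) :
    minor E (Fin.snoc ρ b) (Fin.snoc κ a) = minor E ρ κ *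
      (E b a - ((fun l => E b (κ l)) ᵥ* (Matrix.of fun i j => E (ρ i) (κ j))⁻¹) ⬝ᵥ
        fun k => E (ρ k) a) := by
  have := minor_append E ρ κ ![b] ![a] h
  rw [Fin.append_right_eq_snoc, Fin.append_right_eq_snoc] at this
  simpa using this

lemma append_pair {γ : Type*} (f : Fin n → γ) (u v : γ) :
    (Fin.append f ![u, v] : Fin (n + 2) → γ) = Fin.snoc (Fin.snoc f u) v := by
  ext i
  refine Fin.lastCases ?_ (fun i => ?_) i
  · rw [Fin.snoc_last, show Fin.last (n + 1) = Fin.natAdd n (1 : Fin 2) from rfl,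
      Fin.append_right]
    rfl
  · rw [Fin.snoc_castSucc]
    refine Fin.lastCases ?_ (fun i => ?_) i
    · rw [Fin.snoc_last, show (Fin.last n).castSucc = Fin.natAdd n (0 : Fin 2) from rfl,
        Fin.append_right]
      rfl
    · rw [Fin.snoc_castSucc, show i.castSucc.castSucc = Fin.castAdd 2 i from rfl,
        Fin.append_left]

/-- The Desnanot–Jacobi identity for bordered determinants. -/
lemma minor_mul_minor_snoc_snoc (b b' : α) (a a' : β) (h : minor E ρ κ ≠ 0) :
    minor E (Fin.snoc (Fin.snoc ρ b) b') (Fin.snoc (Fin.snoc κ a) a') * minor E ρ κ =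
      minor E (Fin.snoc ρ b) (Fin.snoc κ a) * minor E (Fin.snoc ρ b') (Fin.snoc κ a') -
      minor E (Fin.snoc ρ b) (Fin.snoc κ a') * minor E (Fin.snoc ρ b') (Fin.snoc κ a) := by
  -- Each singly bordered minor is `minor E ρ κ` times one entry of the Schur complement, so the
  -- identity is the formula for a 2 × 2 determinant.
  have h2 := minor_append E ρ κ ![b, b'] ![a, a'] h
  rw [append_pair, append_pair] at h2
  rw [h2]
  simp only [minor_snoc E ρ κ _ _ h, det_fin_two, Matrix.of_apply, Matrix.cons_val_zero,
    Matrix.cons_val_one]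
  ring

section Derivative

variable {ι : Type*} [Fintype ι] [DecidableEq ι]

/-- The directional derivative of the determinant at `P` in the direction `H`. -/
noncomputable def detDeriv (P H : Matrix ι ι ℝ) : ℝ := ∑ k, (P.updateRow k (H k)).det

lemma hasDerivAt_det {P : ℝ → Matrix ι ι ℝ} {P' : Matrix ι ι ℝ} {t : ℝ}
    (h : ∀ i j, HasDerivAt (fun s => P s i j) (P' i j) t) :
    HasDerivAt (fun s => (P s).det) (detDeriv (P t) P') t := by
  have h1 : HasDerivAt (fun s => (fun i j => P s i j : ι → ι → ℝ)) (fun i j => P' i j) t :=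
    hasDerivAt_pi.2 fun i => hasDerivAt_pi.2 fun j => h i j
  let D : ContinuousMultilinearMap ℝ (fun _ : ι => ι → ℝ) ℝ :=
    { (Matrix.detRowAlternating (n := ι) (R := ℝ)).toMultilinearMap with
      cont := by
        change Continuous fun M : Matrix ι ι ℝ => M.det
        fun_prop }
  have h2 := (D.hasFDerivAt (fun i j => P t i j)).comp_hasDerivAt t h1
  rw [ContinuousMultilinearMap.linearDeriv_apply] at h2
  exact h2

/-- Both sides are the derivative at 0 of s ↦ det(P + sH), which does not change under
transposition. This lets row and column expansions of the derivative be used interchangeably. -/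
lemma detDeriv_transpose (P H : Matrix ι ι ℝ) : detDeriv Pᵀ Hᵀ = detDeriv P H := by
  have h (P H : Matrix ι ι ℝ) :
      HasDerivAt (fun s : ℝ => (P + s • H).det) (detDeriv P H) 0 := by
    have := hasDerivAt_det (P := fun s : ℝ => P + s • H) (P' := H) (t := 0) fun i j => by
      simpa using ((hasDerivAt_id (0 : ℝ)).mul_const (H i j)).const_add (P i j)
    simpa using this
  refine (h Pᵀ Hᵀ).unique ?_
  have e (s : ℝ) : (Pᵀ + s • Hᵀ).det = (P + s • H).det := by
    rw [← det_transpose]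
    simp
  simpa only [e] using h P H

lemma detDeriv_eq_sum_updateCol (P H : Matrix ι ι ℝ) :
    detDeriv P H = ∑ k, (P.updateCol k fun i => H i k).det := by
  rw [← detDeriv_transpose, detDeriv]
  refine Finset.sum_congr rfl fun k _ => ?_
  rw [← det_transpose, updateRow_transpose, transpose_transpose]
  rfl

lemma detDeriv_add (P H K : Matrix ι ι ℝ) : detDeriv P (H + K) = detDeriv P H + detDeriv P K := by
  simp only [detDeriv, ← Finset.sum_add_distrib, ← det_updateRow_add]
  rfl

end Derivative

lemma det_snoc_corner (P : Matrix (Fin n) (Fin n) ℝ) (u v : Fin n → ℝ) (d : ℝ) :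
    (Matrix.of (Fin.snoc (fun i => Fin.snoc (P i) (u i)) (Fin.snoc v d) :
      Fin (n + 1) → Fin (n + 1) → ℝ)).det =
    (Matrix.fromBlocks P (Matrix.replicateCol (Fin 1) u) (Matrix.replicateRow (Fin 1) v)
      (Matrix.of fun _ _ => d)).det := by
  rw [← det_submatrix_equiv_self finSumFinEquiv]
  congr 1
  ext i j
  have h0 (i : Fin 1) : Fin.natAdd n i = Fin.last n := by ext; simp [Subsingleton.elim i 0]
  have h1 (i : Fin n) : Fin.castAdd 1 i = i.castSucc := rfl
  rcases i with i | i <;> rcases j with j | j <;> simp [h0, h1]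

/-- By the Schur complement, det(P - s u vᵀ) is the determinant of P bordered by s u, v and the
corner 1. Splitting the last row into corner 0 plus a unit vector shows it to be det P plus s times
the determinant with corner 0. The slope in s is therefore the bordered determinant, and the
direction u vᵀ reverses its sign. -/
lemma detDeriv_vecMulVec (P : Matrix (Fin n) (Fin n) ℝ) (u v : Fin n → ℝ) :
    detDeriv P (Matrix.of fun i j => u i * v j) =
      - (Matrix.of (Fin.snoc (fun i => Fin.snoc (P i) (u i)) (Fin.snoc v 0) :
      Fin (n + 1) → Fin (n + 1) → ℝ)).det := by
  set W : ℝ → ℝ → Matrix (Fin (n + 1)) (Fin (n + 1)) ℝ := fun s d =>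
    Matrix.of (Fin.snoc (fun i => Fin.snoc (P i) (s * u i)) (Fin.snoc v d)) with hW
  have h1 (s : ℝ) : (P - s • (Matrix.of fun i j => u i * v j)).det = (W s 1).det := by
    simp only [hW]
    rw [det_snoc_corner, show (Matrix.of fun (_ : Fin 1) (_ : Fin 1) => (1 : ℝ)) = 1 by
      ext i j; rw [Subsingleton.elim i j]; simp, det_fromBlocks_one₂₂]
    congr 1
    ext i j
    simp [Matrix.mul_apply, mul_assoc]
  have h2 (s : ℝ) : (W s 1).det = P.det + s * (W 1 0).det := by
    have e1 : W s 1 = (W s 0).updateRow (Fin.last n)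
        ((fun j => W s 0 (Fin.last n) j) + (Pi.single (Fin.last n) 1)) := by
      ext i j
      refine Fin.lastCases ?_ (fun i => ?_) i <;> refine Fin.lastCases ?_ (fun j => ?_) j <;>
        simp [hW]
    have e2 : (W s 0).updateRow (Fin.last n) (Pi.single (Fin.last n) 1) =
        Matrix.of (Fin.snoc (fun i => Fin.snoc (P i) (s * u i)) (Fin.snoc 0 1)) := by
      ext i j
      refine Fin.lastCases ?_ (fun i => ?_) i <;> refine Fin.lastCases ?_ (fun j => ?_) j <;>
        simp [hW]
    have e3 : W s 0 = (W 1 0).updateCol (Fin.last n) (s • fun i => W 1 0 i (Fin.last n)) := by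
      ext i j
      refine Fin.lastCases ?_ (fun i => ?_) i <;> refine Fin.lastCases ?_ (fun j => ?_) j <;>
        simp [hW]
    rw [e1, det_updateRow_add, e2, det_snoc_corner]
    rw [show Matrix.replicateRow (Fin 1) (0 : Fin n → ℝ) = 0 from rfl, det_fromBlocks_zero₂₁]
    rw [show (W s 0).updateRow (Fin.last n) (fun j => W s 0 (Fin.last n) j) = W s 0 from
      updateRow_eq_self _ _, e3, det_updateCol_smul, updateCol_eq_self]
    simp
    ring
  have h3 : HasDerivAt (fun s : ℝ => (P - s • (Matrix.of fun i j => u i * v j)).det)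
      (detDeriv P (Matrix.of fun i j => -(u i * v j))) 0 := by
    have := hasDerivAt_det (P := fun s : ℝ => P - s • (Matrix.of fun i j => u i * v j))
      (P' := Matrix.of fun i j => -(u i * v j)) (t := 0) fun i j => by
      simpa using ((hasDerivAt_id (0 : ℝ)).mul_const (u i * v j)).const_sub (P i j)
    simpa using this
  have h4 : HasDerivAt (fun s : ℝ => (P - s • (Matrix.of fun i j => u i * v j)).det)
      ((W 1 0).det) 0 := by
    simp only [h1, h2]
    simpa using ((hasDerivAt_id (0 : ℝ)).mul_const (W 1 0).det).const_add P.det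
  have h5 := h3.unique h4
  have h6 : detDeriv P (Matrix.of fun i j => u i * v j) +
      detDeriv P (Matrix.of fun i j => -(u i * v j)) = 0 := by
    rw [← detDeriv_add, show (Matrix.of fun i j => u i * v j) +
      (Matrix.of fun i j => -(u i * v j)) = 0 by ext; simp]
    refine Finset.sum_eq_zero fun k _ => det_eq_zero_of_row_eq_zero k fun j => by simp
  simp only [hW, one_mul] at h5
  linarith

/-- A rank one evolution of an array differentiates a minor to the bordered minor. -/
lemma hasDerivAt_minor {E : ℝ → α → β → ℝ} {t : ℝ} {a₀ : α} {b₀ : β} (h0 : E t a₀ b₀ = 0)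
    (h : ∀ i j, HasDerivAt (fun s => E s (ρ i) (κ j)) (E t (ρ i) b₀ * E t a₀ (κ j)) t) :
    HasDerivAt (fun s => minor (E s) ρ κ) (-minor (E t) (Fin.snoc ρ a₀) (Fin.snoc κ b₀)) t := by
  have := hasDerivAt_det (P := fun s => Matrix.of fun i j => E s (ρ i) (κ j))
    (P' := Matrix.of fun i j => E t (ρ i) b₀ * E t a₀ (κ j)) h
  rw [detDeriv_vecMulVec] at this
  refine this.congr_deriv (neg_inj.2 (congrArg Matrix.det ?_))
  ext i j
  refine Fin.lastCases ?_ (fun i => ?_) i <;> refine Fin.lastCases ?_ (fun j => ?_) j <;>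
        simp [h0]

end CauchyTwoMatrix

/-! ### The bordered moment array: bilinear identities and time derivatives. -/

namespace CauchyTwoMatrix

open Matrix

/-- The array `m` with an additional column `a` and an additional row `b`. -/
def bordered (m : ℕ → ℕ → ℝ) (a b : ℕ → ℝ) : Option ℕ → Option ℕ → ℝ
  | some i, some j => m i j
  | some i, none => a i
  | none, some j => b j
  | none, none => 0

lemma bordered_swap (m : ℕ → ℕ → ℝ) (a b : ℕ → ℝ) :
    bordered (fun i j => m j i) b a = fun i j => bordered m a b j i := by
  funext i j
  rcases i with _ | i <;> rcases j with _ | j <;> rfl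

/-- The labels `0, …, n - 1`. -/
def idx (n : ℕ) (i : Fin n) : Option ℕ := some (i : ℕ)

lemma idx_succ (n : ℕ) : idx (n + 1) = Fin.snoc (idx n) (some n) := by
  funext i
  refine Fin.lastCases ?_ (fun i => ?_) i <;> simp [idx]

variable (m : ℕ → ℕ → ℝ) (a b : ℕ → ℝ)

noncomputable def tauDet (n : ℕ) : ℝ := minor (bordered m a b) (idx n) (idx n)

noncomputable def sigmaDet (n : ℕ) : ℝ := minor (bordered m a b) (Fin.snoc (idx n) none) (idx (n + 1))

/-- The value 0 at `n = 0` matches the empty sum in the integral and the empty row shift. -/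
noncomputable def xiDet : ℕ → ℝ
  | 0 => 0
  | n + 1 => minor (bordered m a b) (Fin.snoc (idx n) (some (n + 1))) (idx (n + 1))

/-- The hatted functions are the unhatted ones of the transposed array with the borders exchanged,
so they need no definitions of their own. -/
lemma sigmaDet_swap (n : ℕ) : sigmaDet (fun i j => m j i) b a n =
    minor (bordered m a b) (idx (n + 1)) (Fin.snoc (idx n) none) := by
  rw [sigmaDet, bordered_swap, minor_swap]

lemma xiDet_swap (n : ℕ) : xiDet (fun i j => m j i) b a (n + 1) =
    minor (bordered m a b) (idx (n + 1)) (Fin.snoc (idx n) (some (n + 1))) := by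
  rw [xiDet, bordered_swap, minor_swap]

lemma tauDet_zero : tauDet m a b 0 = 1 := by simp [tauDet, minor]

/-- Replacing row k by row k + 1 duplicates a row unless k is the last index, so one term of the sum
survives. -/
lemma detDeriv_shift {n : ℕ} (f : ℕ → Fin (n + 1) → ℝ) :
    detDeriv (Matrix.of fun i : Fin (n + 1) => f i) (Matrix.of fun i : Fin (n + 1) => f (i + 1)) =
      (Matrix.of fun i => (Fin.snoc (fun i : Fin n => f i) (f (n + 1)) :
        Fin (n + 1) → Fin (n + 1) → ℝ) i).det := by
  rw [detDeriv, Fin.sum_univ_castSucc, Finset.sum_eq_zero, zero_add]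
  · congr 1
    ext i j
    refine Fin.lastCases ?_ (fun i => ?_) i <;> simp
  · intro i _
    refine det_zero_of_row_eq (i := i.castSucc) (j := i.succ) (Fin.castSucc_lt_succ).ne ?_
    rw [updateRow_self, updateRow_ne (Fin.castSucc_lt_succ).ne']
    ext j
    simp

lemma xiDet_eq_detDeriv (n : ℕ) : xiDet m a b n =
    detDeriv (Matrix.of fun i j : Fin n => m i j) (Matrix.of fun i j : Fin n => m (i + 1) j) := by
  rcases n with _ | n
  · simp [xiDet, detDeriv]
  · refine Eq.trans ?_ (detDeriv_shift fun i (j : Fin (n + 1)) => m i j).symm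
    rw [xiDet, minor]
    congr 1
    ext i j
    refine Fin.lastCases ?_ (fun i => ?_) i <;> simp [bordered, idx]

/-- ξ is the derivative of det m along the row shift and ξ̂ along the column shift. By `hm` the two
directions add up to a rank one matrix, to which `detDeriv_vecMulVec` applies. -/
lemma xiDet_add_xiDet_swap (hm : ∀ i j, m (i + 1) j + m i (j + 1) = a i * b j) (n : ℕ) :
    xiDet m a b n + xiDet (fun i j => m j i) b a n =
      -minor (bordered m a b) (Fin.snoc (idx n) none) (Fin.snoc (idx n) none) := by
  rw [xiDet_eq_detDeriv, xiDet_eq_detDeriv (fun i j => m j i),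
    ← detDeriv_transpose (Matrix.of fun i j : Fin n => m j i)]
  have := detDeriv_add (Matrix.of fun i j : Fin n => m i j)
    (Matrix.of fun i j : Fin n => m (i + 1) j) (Matrix.of fun i j : Fin n => m i (j + 1))
  rw [show (Matrix.of fun i j : Fin n => m (i + 1) j) + (Matrix.of fun i j : Fin n => m i (j + 1)) =
    Matrix.of fun i j : Fin n => a i * b j by ext i j; simp [hm],
    detDeriv_vecMulVec _ (fun i : Fin n => a i) (fun j : Fin n => b j)] at this
  refine (this.symm.trans ?_)
  rw [minor]
  congr 2
  ext i j
  refine Fin.lastCases ?_ (fun i => ?_) i <;> refine Fin.lastCases ?_ (fun j => ?_) j <;>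
    simp [bordered, idx]

variable {m a b}

lemma minor_desnanot {n : ℕ} (h : tauDet m a b n ≠ 0) (i i' j j' : Option ℕ) :
    minor (bordered m a b) (Fin.snoc (Fin.snoc (idx n) i) i') (Fin.snoc (Fin.snoc (idx n) j) j') *
      tauDet m a b n =
    minor (bordered m a b) (Fin.snoc (idx n) i) (Fin.snoc (idx n) j) *
      minor (bordered m a b) (Fin.snoc (idx n) i') (Fin.snoc (idx n) j') -
    minor (bordered m a b) (Fin.snoc (idx n) i) (Fin.snoc (idx n) j') *
      minor (bordered m a b) (Fin.snoc (idx n) i') (Fin.snoc (idx n) j) :=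
  minor_mul_minor_snoc_snoc _ _ _ _ _ _ _ h

/-- `τₙ₊₁' τₙ - τₙ₊₁ τₙ' = σₙ σ̂ₙ`, with the derivatives written through `ξ` and `ξ̂`. -/
lemma tau_wronskian (hm : ∀ i j, m (i + 1) j + m i (j + 1) = a i * b j) {n : ℕ}
    (h : tauDet m a b n ≠ 0) :
    (xiDet m a b (n + 1) + xiDet (fun i j => m j i) b a (n + 1)) * tauDet m a b n -
      tauDet m a b (n + 1) * (xiDet m a b n + xiDet (fun i j => m j i) b a n) =
    sigmaDet m a b n * sigmaDet (fun i j => m j i) b a n := by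
  have := minor_desnanot h (some n) none (some n) none
  rw [xiDet_add_xiDet_swap m a b hm, xiDet_add_xiDet_swap m a b hm, sigmaDet_swap m a b, sigmaDet,
    tauDet, tauDet] at *
  rw [idx_succ]
  linear_combination -this

/-- `ξₙ' τₙ - ξₙ τₙ' = σ̂ₙ σₙ₋₁`. -/
lemma xi_wronskian (hm : ∀ i j, m (i + 1) j + m i (j + 1) = a i * b j) {n : ℕ}
    (h : tauDet m a b n ≠ 0) :
    -minor (bordered m a b) (Fin.snoc (Fin.snoc (idx n) (some (n + 1))) none)
        (Fin.snoc (idx (n + 1)) none) * tauDet m a b (n + 1) -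
      xiDet m a b (n + 1) * (xiDet m a b (n + 1) + xiDet (fun i j => m j i) b a (n + 1)) =
    sigmaDet (fun i j => m j i) b a (n + 1) * sigmaDet m a b n := by
  have e1 := minor_desnanot h (some (n + 1)) none (some n) none
  have e2 := minor_desnanot h (some n) none (some n) none
  have e3 := minor_desnanot h (some n) (some (n + 1)) (some n) none
  -- After multiplication by τₙ, Jacobi expresses each minor of size n + 2 as a 2 × 2 determinant of
  -- minors of size n + 1. What remains is the expansion of a 3 × 3 determinant with a repeated
  -- column, rows n, n + 1, `none` and columns n, n, `none`.
  apply mul_right_cancel₀ h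
  rw [xiDet_add_xiDet_swap m a b hm, sigmaDet_swap m a b, xiDet, sigmaDet, tauDet, tauDet] at *
  rw [idx_succ (n + 1), idx_succ n]
  linear_combination (-minor (bordered m a b) (Fin.snoc (idx n) (some n))
      (Fin.snoc (idx n) (some n))) * e1 +
    minor (bordered m a b) (Fin.snoc (idx n) (some (n + 1))) (Fin.snoc (idx n) (some n)) * e2 -
    minor (bordered m a b) (Fin.snoc (idx n) none) (Fin.snoc (idx n) (some n)) * e3

/-- This and `sigma_shift_row` rewrite the two shifted minors that make up σ' in terms of τ, σ, ξ
and ξ̂. -/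
lemma sigma_shift_col {n : ℕ} (h : tauDet m a b n ≠ 0) :
    minor (bordered m a b) (Fin.snoc (idx n) none) (Fin.snoc (idx n) (some (n + 1))) *
      tauDet m a b (n + 1) =
    sigmaDet m a b (n + 1) * tauDet m a b n +
      sigmaDet m a b n * xiDet (fun i j => m j i) b a (n + 1) := by
  have e1 := minor_desnanot h (some n) none (some n) (some (n + 1))
  rw [xiDet_swap m a b, sigmaDet, sigmaDet, tauDet, tauDet] at *
  rw [idx_succ (n + 1), idx_succ n]
  linear_combination -e1

lemma sigma_shift_row {n : ℕ} (h : tauDet m a b n ≠ 0) :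
    minor (bordered m a b) (Fin.snoc (Fin.snoc (idx n) (some (n + 1))) none) (idx (n + 2)) *
      tauDet m a b (n + 1) =
    sigmaDet m a b (n + 1) * xiDet m a b (n + 1) - tauDet m a b (n + 2) * sigmaDet m a b n := by
  have e1 := minor_desnanot h (some (n + 1)) none (some n) (some (n + 1))
  have e2 := minor_desnanot h (some n) none (some n) (some (n + 1))
  have e3 := minor_desnanot h (some n) (some (n + 1)) (some n) (some (n + 1))
  -- The same 3 × 3 argument, now with columns n, n, n + 1.
  apply mul_right_cancel₀ h
  rw [xiDet, sigmaDet, sigmaDet, tauDet, tauDet, tauDet] at *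
  rw [idx_succ (n + 1), idx_succ n]
  linear_combination (minor (bordered m a b) (Fin.snoc (idx n) (some n))
      (Fin.snoc (idx n) (some n))) * e1 -
    minor (bordered m a b) (Fin.snoc (idx n) (some (n + 1))) (Fin.snoc (idx n) (some n)) * e2 +
    minor (bordered m a b) (Fin.snoc (idx n) none) (Fin.snoc (idx n) (some n)) * e3

variable (m a b) in
/-- The derivative of `σₙ`: one column shift plus one row shift. -/
noncomputable def sigmaDetDeriv : ℕ → ℝ
  | 0 => minor (bordered m a b) (Fin.snoc (idx 0) none) (Fin.snoc (idx 0) (some 1))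
  | n + 1 =>
    minor (bordered m a b) (Fin.snoc (idx (n + 1)) none) (Fin.snoc (idx (n + 1)) (some (n + 2))) +
    minor (bordered m a b) (Fin.snoc (Fin.snoc (idx n) (some (n + 1))) none) (idx (n + 2))

lemma detDeriv_sigma_col (n : ℕ) :
    detDeriv (Matrix.of fun i j : Fin (n + 1) =>
        bordered m a b ((Fin.snoc (idx n) none : Fin (n + 1) → Option ℕ) i) (some j))
      (Matrix.of fun i j : Fin (n + 1) =>
        bordered m a b ((Fin.snoc (idx n) none : Fin (n + 1) → Option ℕ) i) (some (j + 1))) =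
    minor (bordered m a b) (Fin.snoc (idx n) none) (Fin.snoc (idx n) (some (n + 1))) := by
  rw [← detDeriv_transpose]
  refine (detDeriv_shift fun k (i : Fin (n + 1)) =>
    bordered m a b ((Fin.snoc (idx n) none : Fin (n + 1) → Option ℕ) i) (some k)).trans ?_
  rw [← minor_swap, minor]
  congr 1
  ext i j
  refine Fin.lastCases ?_ (fun i => ?_) i <;> simp [idx]

/-- Only the moment rows are shifted; the direction vanishes on the φ row. Every shift but that of
the last moment row duplicates a row. -/
lemma detDeriv_sigma_row (n : ℕ) :
    detDeriv (Matrix.of fun i j : Fin (n + 2) =>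
        bordered m a b ((Fin.snoc (idx (n + 1)) none : Fin (n + 2) → Option ℕ) i) (some j))
      (Matrix.of (Fin.snoc (fun (i : Fin (n + 1)) (j : Fin (n + 2)) => m (i + 1) j) 0 :
        Fin (n + 2) → Fin (n + 2) → ℝ)) =
    minor (bordered m a b) (Fin.snoc (Fin.snoc (idx n) (some (n + 1))) none) (idx (n + 2)) := by
  rw [detDeriv, Fin.sum_univ_castSucc, Fin.sum_univ_castSucc, add_assoc, Finset.sum_eq_zero,
    zero_add, add_eq_left.2, minor]
  · congr 1
    ext i j
    refine Fin.lastCases ?_ (fun i => ?_) i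
    · rw [updateRow_ne (Fin.castSucc_lt_last _).ne']
      simp [idx]
    · refine Fin.lastCases ?_ (fun i => ?_) i
      · simp [idx, bordered]
      · rw [updateRow_ne (by simp [Fin.ext_iff]; omega)]
        simp [idx, bordered]
  · exact det_eq_zero_of_row_eq_zero (Fin.last (n + 1)) fun j => by simp
  · intro i _
    have hne : i.castSucc.castSucc ≠ i.succ.castSucc := by simp [Fin.ext_iff]
    refine det_zero_of_row_eq hne ?_
    rw [updateRow_self, updateRow_ne hne.symm]
    ext j
    rw [Matrix.of_apply, Matrix.of_apply, Fin.snoc_castSucc, Fin.snoc_castSucc]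
    simp [idx, bordered]

section Evolution

variable {m : ℝ → ℕ → ℕ → ℝ} {a b : ℝ → ℕ → ℝ} {t : ℝ}

lemma hasDerivAt_tauDet (hm : ∀ i j, m t (i + 1) j + m t i (j + 1) = a t i * b t j)
    (dm : ∀ i j, HasDerivAt (fun s => m s i j) (a t i * b t j) t) (n : ℕ) :
    HasDerivAt (fun s => tauDet (m s) (a s) (b s) n)
      (xiDet (m t) (a t) (b t) n + xiDet (fun i j => m t j i) (b t) (a t) n) t := by
  rw [xiDet_add_xiDet_swap _ _ _ hm]
  exact hasDerivAt_minor (E := fun s => bordered (m s) (a s) (b s)) _ _ rfl fun i j => dm _ _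

lemma hasDerivAt_xiDet
    (dm : ∀ i j, HasDerivAt (fun s => m s i j) (a t i * b t j) t) (n : ℕ) :
    HasDerivAt (fun s => xiDet (m s) (a s) (b s) (n + 1))
      (-minor (bordered (m t) (a t) (b t)) (Fin.snoc (Fin.snoc (idx n) (some (n + 1))) none)
        (Fin.snoc (idx (n + 1)) none)) t := by
  refine hasDerivAt_minor (E := fun s => bordered (m s) (a s) (b s)) _ _ rfl fun i j => ?_
  refine Fin.lastCases ?_ (fun i => ?_) i
  · simpa [idx, bordered] using dm _ _
  · simpa [idx, bordered] using dm _ _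

/-- The φ row moves by a column shift because ∂bⱼ = bⱼ₊₁, and by `hm` the moment rows move by a
column shift plus a row shift. The total direction is thus a column shift of the whole matrix plus a
row shift of its moment rows. -/
lemma hasDerivAt_sigmaDet (hm : ∀ i j, m t (i + 1) j + m t i (j + 1) = a t i * b t j)
    (dm : ∀ i j, HasDerivAt (fun s => m s i j) (a t i * b t j) t)
    (db : ∀ j, HasDerivAt (fun s => b s j) (b t (j + 1)) t) (n : ℕ) :
    HasDerivAt (fun s => sigmaDet (m s) (a s) (b s) n) (sigmaDetDeriv (m t) (a t) (b t) n) t := by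
  have h := hasDerivAt_det (t := t)
    (P := fun s => Matrix.of fun i j => bordered (m s) (a s) (b s)
      ((Fin.snoc (idx n) none : Fin (n + 1) → Option ℕ) i) (idx (n + 1) j))
    (P' := Matrix.of (Fin.snoc (fun (i : Fin n) (j : Fin (n + 1)) => a t i * b t j)
      (fun j => b t (j + 1)) : Fin (n + 1) → Fin (n + 1) → ℝ)) fun i j => by
    refine Fin.lastCases ?_ (fun i => ?_) i
    · simpa [idx, bordered] using db j
    · simpa [idx, bordered] using dm i j
  refine h.congr_deriv ?_
  rcases n with _ | n
  · rw [sigmaDetDeriv, ← detDeriv_sigma_col]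
    congr 1
  · rw [sigmaDetDeriv, ← detDeriv_sigma_col, ← detDeriv_sigma_row, ← detDeriv_add]
    refine Finset.sum_congr rfl fun k _ => ?_
    refine Fin.lastCases ?_ (fun k => ?_) k
    · congr 2
      ext j
      simp [bordered]
    · have e : (fun j => a t k * b t j : Fin (n + 2) → ℝ) =
          (fun j : Fin (n + 2) => m t k (j + 1)) + fun j : Fin (n + 2) => m t (k + 1) j := by
        ext j
        simp [← hm, add_comm]
      congr 2
      ext j
      simpa [bordered, idx] using congrFun e j

end Evolution

end CauchyTwoMatrix

/-! ### From the bilinear relations to the lattice equations. -/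

namespace CauchyTwoMatrix

/-- The bilinear relations between the tau functions and their derivatives at the time `t`. -/
structure TauFlow (T X Y S Z : ℕ → ℝ → ℝ) (t : ℝ) : Prop where
  tau_zero : T 0 t = 1
  xi_zero : X 0 t = 0
  tau_ne : ∀ n, T n t ≠ 0
  sigma_ne : ∀ n, S n t ≠ 0
  sigmaHat_ne : ∀ n, Z n t ≠ 0
  deriv_tau : ∀ n, HasDerivAt (T n) (X n t + Y n t) t
  wronskian : ∀ n, (X (n + 1) t + Y (n + 1) t) * T n t - T (n + 1) t * (X n t + Y n t) =
    S n t * Z n t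
  deriv_xi_zero : HasDerivAt (X 0) 0 t
  deriv_xi : ∀ n, ∃ d, HasDerivAt (X (n + 1)) d t ∧
    d * T (n + 1) t - X (n + 1) t * (X (n + 1) t + Y (n + 1) t) = Z (n + 1) t * S n t
  deriv_sigma_zero : ∃ d, HasDerivAt (S 0) d t ∧ d * T 1 t = S 1 t * T 0 t + S 0 t * Y 1 t
  deriv_sigma : ∀ n, ∃ d e, HasDerivAt (S (n + 1)) (d + e) t ∧
    d * T (n + 2) t = S (n + 2) t * T (n + 1) t + S (n + 1) t * Y (n + 2) t ∧
    e * T (n + 1) t = S (n + 1) t * X (n + 1) t - T (n + 2) t * S n t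

/-- Derivatives are kept in the logarithmic form f · p, so that for the products and quotients
defining A and C the factors p merely add and subtract. -/
lemma HasDerivAt.mul_log {f g : ℝ → ℝ} {p q t : ℝ} (hf : HasDerivAt f (f t * p) t)
    (hg : HasDerivAt g (g t * q) t) :
    HasDerivAt (fun s => f s * g s) (f t * g t * (p + q)) t :=
  (hf.mul hg).congr_deriv (by ring)

lemma HasDerivAt.div_log {f g : ℝ → ℝ} {p q t : ℝ} (hf : HasDerivAt f (f t * p) t)
    (hg : HasDerivAt g (g t * q) t) (h : g t ≠ 0) :
    HasDerivAt (fun s => f s / g s) (f t / g t * (p - q)) t :=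
  (hf.div hg h).congr_deriv (by field_simp)

lemma TauFlow.congr {T X Y S Z T' X' Y' S' Z' : ℕ → ℝ → ℝ} {t : ℝ} (h : TauFlow T X Y S Z t)
    (hT : ∀ n, T' n =ᶠ[nhds t] T n) (hX : ∀ n, X' n =ᶠ[nhds t] X n)
    (hY : ∀ n, Y' n =ᶠ[nhds t] Y n) (hS : ∀ n, S' n =ᶠ[nhds t] S n)
    (hZ : ∀ n, Z' n =ᶠ[nhds t] Z n) : TauFlow T' X' Y' S' Z' t := by
  have eT n := (hT n).eq_of_nhds
  have eX n := (hX n).eq_of_nhds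
  have eY n := (hY n).eq_of_nhds
  have eS n := (hS n).eq_of_nhds
  have eZ n := (hZ n).eq_of_nhds
  constructor <;> simp only [eT, eX, eY, eS, eZ, (hT _).hasDerivAt_iff, (hX _).hasDerivAt_iff,
    (hS _).hasDerivAt_iff]
  · exact h.tau_zero
  · exact h.xi_zero
  · exact h.tau_ne
  · exact h.sigma_ne
  · exact h.sigmaHat_ne
  · exact h.deriv_tau
  · exact h.wronskian
  · exact h.deriv_xi_zero
  · exact h.deriv_xi
  · exact h.deriv_sigma_zero
  · exact h.deriv_sigma

namespace TauFlow

variable {T X Y S Z : ℕ → ℝ → ℝ} {t : ℝ} (h : TauFlow T X Y S Z t)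
include h

lemma tau_log (n : ℕ) : HasDerivAt (T n) (T n t * ((X n t + Y n t) / T n t)) t :=
  (h.deriv_tau n).congr_deriv (by have := h.tau_ne n; field_simp)

lemma A_succ (n : ℕ) :
    HasDerivAt (fun s => T (n + 2) s * T n s / T (n + 1) s ^ 2)
      (T (n + 2) t * T n t / T (n + 1) t ^ 2 *
        ((X (n + 2) t / T (n + 2) t - X (n + 1) t / T (n + 1) t) +
          (Y (n + 2) t / T (n + 2) t - Y (n + 1) t / T (n + 1) t) -
          (X (n + 1) t / T (n + 1) t - X n t / T n t) -
          (Y (n + 1) t / T (n + 1) t - Y n t / T n t))) t := by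
  have h2 := HasDerivAt.mul_log (h.tau_log (n + 1)) (h.tau_log (n + 1))
  simp only [← sq] at h2
  exact (HasDerivAt.div_log (HasDerivAt.mul_log (h.tau_log (n + 2)) (h.tau_log n)) h2
    (pow_ne_zero 2 (h.tau_ne _))).congr_deriv (by ring)

/-- The quotient rule with the ξ relation gives Zₙ₊₁ Sₙ / Tₙ₊₁²; the Wronskian of τ identifies Bₙ +
B̂ₙ with Sₙ Zₙ / (Tₙ Tₙ₊₁), which extracts that factor. The equation for B is the difference of two
such formulas. -/
lemma xi_div_tau_succ (n : ℕ) :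
    HasDerivAt (fun s => X (n + 1) s / T (n + 1) s)
      (((X (n + 1) t / T (n + 1) t - X n t / T n t) +
        (Y (n + 1) t / T (n + 1) t - Y n t / T n t)) *
        (Z (n + 1) t * T n t / (Z n t * T (n + 1) t))) t := by
  obtain ⟨d, hd, e⟩ := h.deriv_xi n
  have h0 := h.tau_ne n
  have h1 := h.tau_ne (n + 1)
  have hz := h.sigmaHat_ne n
  refine (hd.div (h.deriv_tau (n + 1)) h1).congr_deriv ?_
  rw [e, show (X (n + 1) t / T (n + 1) t - X n t / T n t) +
      (Y (n + 1) t / T (n + 1) t - Y n t / T n t) = S n t * Z n t / (T n t * T (n + 1) t) by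
    rw [← h.wronskian]; field_simp; ring]
  field_simp

lemma B_zero : HasDerivAt (fun s => X 1 s / T 1 s - X 0 s / T 0 s)
    (-(((X 1 t / T 1 t - X 0 t / T 0 t) + (Y 1 t / T 1 t - Y 0 t / T 0 t)) *
      -(Z 1 t * T 0 t / (Z 0 t * T 1 t)))) t := by
  have h0 := (h.deriv_xi_zero.div (h.deriv_tau 0) (h.tau_ne 0))
  exact ((h.xi_div_tau_succ 0).sub h0).congr_deriv (by rw [h.xi_zero]; ring)

lemma B_succ (n : ℕ) :
    HasDerivAt (fun s => X (n + 2) s / T (n + 2) s - X (n + 1) s / T (n + 1) s)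
    (((X (n + 1) t / T (n + 1) t - X n t / T n t) +
        (Y (n + 1) t / T (n + 1) t - Y n t / T n t)) *
        -(Z (n + 1) t * T n t / (Z n t * T (n + 1) t)) -
      ((X (n + 2) t / T (n + 2) t - X (n + 1) t / T (n + 1) t) +
        (Y (n + 2) t / T (n + 2) t - Y (n + 1) t / T (n + 1) t)) *
        -(Z (n + 2) t * T (n + 1) t / (Z (n + 1) t * T (n + 2) t))) t :=
  ((h.xi_div_tau_succ (n + 1)).sub (h.xi_div_tau_succ n)).congr_deriv (by ring)

lemma sigma_log_zero : HasDerivAt (S 0)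
    (S 0 t * (S 1 t * T 0 t / (S 0 t * T 1 t) + Y 1 t / T 1 t)) t := by
  obtain ⟨d, hd, e⟩ := h.deriv_sigma_zero
  have h1 := h.tau_ne 1
  have hs := h.sigma_ne 0
  refine hd.congr_deriv ?_
  rw [eq_div_of_mul_eq h1 e]
  field_simp

lemma sigma_log_succ (n : ℕ) : HasDerivAt (S (n + 1))
    (S (n + 1) t * (S (n + 2) t * T (n + 1) t / (S (n + 1) t * T (n + 2) t) +
      Y (n + 2) t / T (n + 2) t + X (n + 1) t / T (n + 1) t -
      T (n + 2) t * S n t / (S (n + 1) t * T (n + 1) t))) t := by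
  obtain ⟨d, e, hd, e1, e2⟩ := h.deriv_sigma n
  have h1 := h.tau_ne (n + 1)
  have h2 := h.tau_ne (n + 2)
  have hs := h.sigma_ne (n + 1)
  refine hd.congr_deriv ?_
  rw [eq_div_of_mul_eq h2 e1, eq_div_of_mul_eq h1 e2]
  field_simp
  ring

/-- The quotient Aₙ₊₁ / Cₙ is the row shift term in the logarithmic derivative of σₙ₊₁. -/
lemma A_div_C (n : ℕ) :
    T (n + 2) t * T n t / T (n + 1) t ^ 2 / -(S (n + 1) t * T n t / (S n t * T (n + 1) t)) =
      -(T (n + 2) t * S n t / (S (n + 1) t * T (n + 1) t)) := by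
  have h0 := h.tau_ne n
  have h1 := h.tau_ne (n + 1)
  have hs0 := h.sigma_ne n
  have hs := h.sigma_ne (n + 1)
  field_simp

lemma C_ne_zero (n : ℕ) : -(S (n + 1) t * T n t / (S n t * T (n + 1) t)) ≠ 0 :=
  neg_ne_zero.2 (div_ne_zero (mul_ne_zero (h.sigma_ne _) (h.tau_ne _))
    (mul_ne_zero (h.sigma_ne _) (h.tau_ne _)))

lemma C_log {n : ℕ} {p q : ℝ} (hp : HasDerivAt (S (n + 1)) (S (n + 1) t * p) t)
    (hq : HasDerivAt (S n) (S n t * q) t) :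
    HasDerivAt (fun s => -(S (n + 1) s * T n s / (S n s * T (n + 1) s)))
      (-(S (n + 1) t * T n t / (S n t * T (n + 1) t)) *
        (p + (X n t + Y n t) / T n t - (q + (X (n + 1) t + Y (n + 1) t) / T (n + 1) t))) t :=
  ((HasDerivAt.div_log (HasDerivAt.mul_log hp (h.tau_log n))
    (HasDerivAt.mul_log hq (h.tau_log (n + 1)))
    (mul_ne_zero (h.sigma_ne _) (h.tau_ne _))).neg).congr_deriv (by ring)

lemma C_zero (hY : Y 0 t = 0) :
    HasDerivAt (fun s => -(S 1 s * T 0 s / (S 0 s * T 1 s)))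
      (-(S 1 t * T 0 t / (S 0 t * T 1 t)) *
        (-(S 1 t * T 0 t / (S 0 t * T 1 t)) - (Y 1 t / T 1 t - Y 0 t / T 0 t) -
          -(S 2 t * T 1 t / (S 1 t * T 2 t)) +
          T 2 t * T 0 t / T 1 t ^ 2 / -(S 1 t * T 0 t / (S 0 t * T 1 t)) +
          (Y 2 t / T 2 t - Y 1 t / T 1 t))) t := by
  have e := h.A_div_C 0
  rw [zero_add, zero_add] at e
  rw [e]
  refine (h.C_log (h.sigma_log_succ 0) h.sigma_log_zero).congr_deriv ?_
  rw [h.xi_zero, hY]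
  ring

lemma C_succ (n : ℕ) :
    HasDerivAt (fun s => -(S (n + 2) s * T (n + 1) s / (S (n + 1) s * T (n + 2) s)))
      (-(S (n + 2) t * T (n + 1) t / (S (n + 1) t * T (n + 2) t)) *
        (-(S (n + 2) t * T (n + 1) t / (S (n + 1) t * T (n + 2) t)) -
          T (n + 2) t * T n t / T (n + 1) t ^ 2 / -(S (n + 1) t * T n t / (S n t * T (n + 1) t)) -
          (Y (n + 2) t / T (n + 2) t - Y (n + 1) t / T (n + 1) t) -
          -(S (n + 3) t * T (n + 2) t / (S (n + 2) t * T (n + 3) t)) +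
          T (n + 3) t * T (n + 1) t / T (n + 2) t ^ 2 /
            -(S (n + 2) t * T (n + 1) t / (S (n + 1) t * T (n + 2) t)) +
          (Y (n + 3) t / T (n + 3) t - Y (n + 2) t / T (n + 2) t))) t := by
  rw [h.A_div_C n, h.A_div_C (n + 1)]
  exact (h.C_log (h.sigma_log_succ (n + 1)) (h.sigma_log_succ n)).congr_deriv (by ring)

end TauFlow

/-- The flow `h` gives the equations for A, B and C; its mirror image `h'` gives those for B̂ and Ĉ.
-/
theorem isLatticeSolution_of_tauFlow {U : Set ℝ} {μ₁ μ₂ : ℝ → Measure ℝ}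
    (h : ∀ t ∈ U, TauFlow (fun n s => tau (μ₁ s) (μ₂ s) n) (fun n s => xi (μ₁ s) (μ₂ s) n)
      (fun n s => xiHat (μ₁ s) (μ₂ s) n) (fun n s => sigma (μ₁ s) (μ₂ s) n)
      (fun n s => sigmaHat (μ₁ s) (μ₂ s) n) t)
    (h' : ∀ t ∈ U, TauFlow (fun n s => tau (μ₁ s) (μ₂ s) n) (fun n s => xiHat (μ₁ s) (μ₂ s) n)
      (fun n s => xi (μ₁ s) (μ₂ s) n) (fun n s => sigmaHat (μ₁ s) (μ₂ s) n)
      (fun n s => sigma (μ₁ s) (μ₂ s) n) t) :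
    IsLatticeSolution U (fun n t => A (μ₁ t) (μ₂ t) n) (fun n t => B (μ₁ t) (μ₂ t) n)
      (fun n t => BHat (μ₁ t) (μ₂ t) n) (fun n t => C (μ₁ t) (μ₂ t) n)
      (fun n t => CHat (μ₁ t) (μ₂ t) n) where
  C_ne_zero t ht n := (h t ht).C_ne_zero n
  C'_ne_zero t ht n := (h' t ht).C_ne_zero n
  A_zero t _ := rfl
  A_succ t ht n := (h t ht).A_succ n
  B_zero t ht := (h t ht).B_zero
  B_succ t ht n := (h t ht).B_succ n
  B'_zero t ht := (h' t ht).B_zero.congr_deriv (by simp only [B, BHat, C]; ring)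
  B'_succ t ht n := ((h' t ht).B_succ n).congr_deriv (by simp only [B, BHat, C]; ring)
  C_zero t ht := (h t ht).C_zero (h' t ht).xi_zero
  C_succ t ht n := (h t ht).C_succ n
  C'_zero t ht := (h' t ht).C_zero (h t ht).xi_zero
  C'_succ t ht n := (h' t ht).C_succ n

end CauchyTwoMatrix

/-! ### The evolution of the measures and of their moments. -/

namespace CauchyTwoMatrix

open Set Filter Topology

/-- A lower Grönwall bound: e^{-ar} f(r) is nondecreasing. -/
lemma exp_mul_le_of_mul_le_deriv {f f' : ℝ → ℝ} {a s t : ℝ} (hst : s ≤ t)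
    (hf : ∀ r ∈ Icc s t, HasDerivAt f (f' r) r) (hb : ∀ r ∈ Icc s t, a * f r ≤ f' r) :
    Real.exp (a * (t - s)) * f s ≤ f t := by
  have hg : ∀ r ∈ Icc s t, HasDerivAt (fun r => Real.exp (-(a * r)) * f r)
      (Real.exp (-(a * r)) * (f' r - a * f r)) r := fun r hr => by
    have h1 : HasDerivAt (fun r : ℝ => Real.exp (-(a * r))) (Real.exp (-(a * r)) * (-(a * 1))) r :=
      (((hasDerivAt_id r).const_mul a).neg).exp
    exact (h1.mul (hf r hr)).congr_deriv (by ring)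
  have hmono : MonotoneOn (fun r => Real.exp (-(a * r)) * f r) (Icc s t) := by
    refine monotoneOn_of_deriv_nonneg (convex_Icc s t)
      (fun r hr => (hg r hr).continuousAt.continuousWithinAt)
      (fun r hr => (hg r (interior_subset hr)).differentiableAt.differentiableWithinAt)
      fun r hr => ?_
    rw [(hg r (interior_subset hr)).deriv]
    exact mul_nonneg (Real.exp_pos _).le (sub_nonneg.2 (hb r (interior_subset hr)))
  have h := hmono (left_mem_Icc.2 hst) (right_mem_Icc.2 hst) hst
  calc Real.exp (a * (t - s)) * f s
      = Real.exp (a * t) * (Real.exp (-(a * s)) * f s) := by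
        rw [← mul_assoc, ← Real.exp_add]; ring_nf
    _ ≤ Real.exp (a * t) * (Real.exp (-(a * t)) * f t) :=
        mul_le_mul_of_nonneg_left h (Real.exp_pos _).le
    _ = f t := by rw [← mul_assoc, ← Real.exp_add]; simp

lemma measure_eq_tsum_Ico_zsmul (ν : Measure ℝ) {h : ℝ} (hh : 0 < h) {E : Set ℝ}
    (hE : MeasurableSet E) :
    ν E = ∑' k : ℤ, ν (E ∩ Ico (k • h) ((k + 1) • h)) := by
  rw [← measure_iUnion]
  · rw [← inter_iUnion, iUnion_Ico_zsmul hh, inter_univ]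
  · exact fun i j hij => ((pairwise_disjoint_Ico_zsmul h) hij).mono inter_subset_right
      inter_subset_right
  · exact fun k => hE.inter measurableSet_Ico

lemma le_of_forall_exp_mul {x y : ENNReal} {c : ℝ}
    (h : ∀ ε : ℝ, 0 < ε → x ≤ ENNReal.ofReal (Real.exp (ε * c)) * y) : x ≤ y := by
  have h1 : Tendsto (fun ε : ℝ => ENNReal.ofReal (Real.exp (ε * c)) * y) (𝓝[>] 0) (𝓝 (1 * y)) := by
    refine ENNReal.Tendsto.mul_const ?_ (Or.inl one_ne_zero)
    have : Continuous fun ε : ℝ => ENNReal.ofReal (Real.exp (ε * c)) :=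
      ENNReal.continuous_ofReal.comp (by fun_prop)
    have h2 := this.tendsto 0
    simp only [zero_mul, Real.exp_zero, ENNReal.ofReal_one] at h2
    exact h2.mono_left nhdsWithin_le_nhds
  rw [one_mul] at h1
  exact ge_of_tendsto h1 (eventually_nhdsWithin_of_forall fun ε hε => h ε hε)

namespace EvolvesByPosition

variable {μ : ℝ → Measure ℝ} {U : Set ℝ} {s t : ℝ}

/-- On E ⊆ [a, b] the derivative ∫_E x dμ lies between a μ(E) and b μ(E). Grönwall is applied to
μ(E) and to -μ(E). -/
lemma measure_bounds (h : EvolvesByPosition μ U) (hfin : ∀ r ∈ U, IsFiniteMeasure (μ r))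
    (hst : s ≤ t) (hU : Icc s t ⊆ U) {E : Set ℝ} (hE : MeasurableSet E) {a b : ℝ}
    (hab : E ⊆ Icc a b) :
    ENNReal.ofReal (Real.exp (a * (t - s))) * μ s E ≤ μ t E ∧
      μ t E ≤ ENNReal.ofReal (Real.exp (b * (t - s))) * μ s E := by
  have hfs := hfin s (hU (left_mem_Icc.2 hst))
  have hft := hfin t (hU (right_mem_Icc.2 hst))
  have hbd : Bornology.IsBounded E := (Metric.isBounded_Icc a b).subset hab
  have hd : ∀ r ∈ Icc s t, HasDerivAt (fun s => (μ s).real E) (∫ x in E, x ∂(μ r)) r :=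
    fun r hr => h r (hU hr) E hE hbd
  have hint : ∀ r ∈ Icc s t, IntegrableOn (fun x : ℝ => x) E (μ r) := fun r hr => by
    have := hfin r (hU hr)
    refine Measure.integrableOn_of_bounded (M := max |a| |b|) (measure_ne_top _ _)
      aestronglyMeasurable_id ?_
    refine (ae_restrict_mem hE).mono fun x hx => ?_
    exact abs_le_max_abs_abs (hab hx).1 (hab hx).2
  have h1 := exp_mul_le_of_mul_le_deriv (a := a) hst hd fun r hr => by
    have := hfin r (hU hr)
    have h2 := setIntegral_mono_on (integrableOn_const (C := a) (measure_ne_top (μ r) E))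
      (hint r hr) hE fun x hx => (hab hx).1
    rw [setIntegral_const, smul_eq_mul, mul_comm] at h2
    exact h2
  have h2 := exp_mul_le_of_mul_le_deriv (a := b) (f := fun r => -(μ r).real E) hst
    (fun r hr => (hd r hr).neg) fun r hr => by
    have := hfin r (hU hr)
    have h2 := setIntegral_mono_on (hint r hr)
      (integrableOn_const (C := b) (measure_ne_top (μ r) E)) hE fun x hx => (hab hx).2
    rw [setIntegral_const, smul_eq_mul, mul_comm] at h2
    linarith
  rw [← ofReal_measureReal (μ := μ s), ← ofReal_measureReal (μ := μ t),
    ← ENNReal.ofReal_mul (Real.exp_pos _).le, ← ENNReal.ofReal_mul (Real.exp_pos _).le]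
  exact ⟨ENNReal.ofReal_le_ofReal h1, ENNReal.ofReal_le_ofReal (by linarith)⟩

/-- The solution of the evolution equation is the exponential reweighting of the initial
measure. -/
theorem eq_withDensity (h : EvolvesByPosition μ U) (hfin : ∀ r ∈ U, IsFiniteMeasure (μ r))
    (hst : s ≤ t) (hU : Icc s t ⊆ U) :
    μ t = (μ s).withDensity fun x => ENNReal.ofReal (Real.exp ((t - s) * x)) := by
  set ν := (μ s).withDensity fun x => ENNReal.ofReal (Real.exp ((t - s) * x)) with hν
  have hts : 0 ≤ t - s := sub_nonneg.2 hst
  -- The candidate `ν` obeys the same two bounds as `μ t`. On a cell of length ε these differ by the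
  -- factor e^{ε(t-s)}; summing over a grid of mesh ε and letting ε tend to 0 gives both
  -- inequalities.
  have bounds : ∀ {E : Set ℝ} {a b : ℝ}, MeasurableSet E → E ⊆ Icc a b →
      ENNReal.ofReal (Real.exp (a * (t - s))) * μ s E ≤ ν E ∧
      ν E ≤ ENNReal.ofReal (Real.exp (b * (t - s))) * μ s E := by
    intro E a b hE hab
    rw [hν, withDensity_apply _ hE, ← setLIntegral_const, ← setLIntegral_const]
    constructor
    · refine setLIntegral_mono (by fun_prop) fun x hx => ENNReal.ofReal_le_ofReal ?_
      rw [Real.exp_le_exp, mul_comm]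
      exact mul_le_mul_of_nonneg_left (hab hx).1 hts
    · refine setLIntegral_mono (by fun_prop) fun x hx => ENNReal.ofReal_le_ofReal ?_
      rw [Real.exp_le_exp, mul_comm _ (t - s)]
      exact mul_le_mul_of_nonneg_left (hab hx).2 hts
  have hsub (E : Set ℝ) (k : ℤ) (ε : ℝ) :
      E ∩ Ico (k • ε) ((k + 1) • ε) ⊆ Icc (k * ε) ((k + 1) * ε) := fun x hx => by
    have := hx.2
    simp only [zsmul_eq_mul, Int.cast_add, Int.cast_one, mem_Ico] at this
    exact ⟨this.1, this.2.le⟩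
  have hexp (k : ℤ) (ε : ℝ) : ENNReal.ofReal (Real.exp ((k + 1) * ε * (t - s))) =
      ENNReal.ofReal (Real.exp (ε * (t - s))) * ENNReal.ofReal (Real.exp (k * ε * (t - s))) := by
    rw [← ENNReal.ofReal_mul (Real.exp_pos _).le, ← Real.exp_add]
    ring_nf
  ext E hE
  apply le_antisymm
  · refine le_of_forall_exp_mul (c := t - s) fun ε hε => ?_
    rw [measure_eq_tsum_Ico_zsmul _ hε hE, measure_eq_tsum_Ico_zsmul ν hε hE, ← ENNReal.tsum_mul_left]
    refine ENNReal.tsum_le_tsum fun k => ?_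
    have hm := hE.inter (measurableSet_Ico (a := k • ε) (b := (k + 1) • ε))
    refine (h.measure_bounds hfin hst hU hm (hsub E k ε)).2.trans ?_
    rw [hexp, mul_assoc]
    gcongr
    exact (bounds hm (hsub E k ε)).1
  · refine le_of_forall_exp_mul (c := t - s) fun ε hε => ?_
    rw [measure_eq_tsum_Ico_zsmul _ hε hE, measure_eq_tsum_Ico_zsmul (μ t) hε hE,
      ← ENNReal.tsum_mul_left]
    refine ENNReal.tsum_le_tsum fun k => ?_
    have hm := hE.inter (measurableSet_Ico (a := k • ε) (b := (k + 1) • ε))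
    refine (bounds hm (hsub E k ε)).2.trans ?_
    rw [hexp, mul_assoc]
    gcongr
    exact (h.measure_bounds hfin hst hU hm (hsub E k ε)).1

end EvolvesByPosition

section Reweighting

variable {Ω : Type*} [MeasurableSpace Ω]

/-- Since w ≥ 0, the integrand of the derivative at any r < b is dominated by the one at b, so
integrability at a single later time justifies differentiation under the integral. -/
lemma hasDerivAt_integral_mul_exp {ν : Measure Ω} {f w : Ω → ℝ} {s b : ℝ} (hsb : s < b)
    (hw : Measurable w) (hw0 : ∀ᵐ x ∂ν, 0 ≤ w x) (hf : AEStronglyMeasurable f ν)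
    (hf1 : Integrable (fun x => Real.exp (s * w x) * f x) ν)
    (hf2 : Integrable (fun x => Real.exp (b * w x) * (f x * w x)) ν) :
    HasDerivAt (fun r => ∫ x, Real.exp (r * w x) * f x ∂ν)
      (∫ x, Real.exp (s * w x) * (f x * w x) ∂ν) s := by
  refine (hasDerivAt_integral_of_dominated_loc_of_deriv_le
    (F := fun r x => Real.exp (r * w x) * f x)
    (F' := fun r x => Real.exp (r * w x) * (f x * w x))
    (bound := fun x => ‖Real.exp (b * w x) * (f x * w x)‖) (Iio_mem_nhds hsb) ?_ hf1 ?_ ?_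
    hf2.norm ?_).2
  · exact Eventually.of_forall fun r =>
      ((by fun_prop : Measurable fun x => Real.exp (r * w x)).aestronglyMeasurable).mul hf
  · exact ((by fun_prop : Measurable fun x => Real.exp (s * w x)).aestronglyMeasurable).mul
      (hf.mul hw.aestronglyMeasurable)
  · filter_upwards [hw0] with x hx r hr
    simp only [norm_mul, Real.norm_eq_abs, Real.abs_exp]
    gcongr
    exact le_of_lt hr
  · refine Eventually.of_forall fun x r _ => ?_
    have h1 : HasDerivAt (fun r : ℝ => Real.exp (r * w x)) (Real.exp (r * w x) * (1 * w x)) r :=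
      ((hasDerivAt_id r).mul_const (w x)).exp
    exact (h1.mul_const (f x)).congr_deriv (by ring)

/-- The base time is taken strictly before t, so that the measures at times on both sides of t are
forward reweightings of one fixed measure. -/
lemma hasDerivAt_integral_reweighted {μ : ℝ → Measure Ω} {f w : Ω → ℝ} {t₀ t b : ℝ}
    (h0 : t₀ < t) (hb : t < b) (hw : Measurable w) (hw0 : ∀ᵐ x ∂(μ t₀), 0 ≤ w x)
    (hμ : ∀ s ∈ Icc t₀ b,
      μ s = (μ t₀).withDensity fun x => ENNReal.ofReal (Real.exp ((s - t₀) * w x)))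
    (hf : ∀ s ∈ Icc t₀ b, Integrable f (μ s))
    (hfw : ∀ s ∈ Icc t₀ b, Integrable (fun x => f x * w x) (μ s)) :
    HasDerivAt (fun s => ∫ x, f x ∂(μ s)) (∫ x, f x * w x ∂(μ t)) t := by
  have hint (g : Ω → ℝ) (s : ℝ) (hs : s ∈ Icc t₀ b) :
      ∫ x, g x ∂(μ s) = ∫ x, Real.exp ((s - t₀) * w x) * g x ∂(μ t₀) := by
    rw [hμ s hs, integral_withDensity_eq_integral_toReal_smul (by fun_prop)
      (Eventually.of_forall fun x => ENNReal.ofReal_lt_top)]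
    simp [ENNReal.toReal_ofReal (Real.exp_pos _).le]
  have hintg (g : Ω → ℝ) (s : ℝ) (hs : s ∈ Icc t₀ b) (hg : Integrable g (μ s)) :
      Integrable (fun x => Real.exp ((s - t₀) * w x) * g x) (μ t₀) := by
    rw [hμ s hs, integrable_withDensity_iff_integrable_smul' (by fun_prop)
      (Eventually.of_forall fun x => ENNReal.ofReal_lt_top)] at hg
    simpa [ENNReal.toReal_ofReal (Real.exp_pos _).le] using hg
  have ht : t ∈ Icc t₀ b := ⟨h0.le, hb.le⟩
  have hb' : b ∈ Icc t₀ b := ⟨(h0.trans hb).le, le_rfl⟩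
  have h1 := hasDerivAt_integral_mul_exp (sub_lt_sub_right hb t₀) hw hw0
    (hf t₀ ⟨le_rfl, (h0.trans hb).le⟩).aestronglyMeasurable (hintg f t ht (hf t ht))
    (hintg _ b hb' (hfw b hb'))
  have h2 := h1.comp_sub_const t t₀
  rw [← hint _ t ht] at h2
  refine h2.congr_of_eventuallyEq ?_
  filter_upwards [Icc_mem_nhds h0 hb] with s hs using hint f s hs

end Reweighting

namespace AdmissiblePair

variable {μ₁ μ₂ : Measure ℝ} (h : AdmissiblePair μ₁ μ₂)
include h

lemma finite₁ : IsFiniteMeasure μ₁ := by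
  have := h.moment₁ 0
  simp only [pow_zero] at this
  simpa [integrable_const_iff, isFiniteMeasure_iff] using this

lemma finite₂ : IsFiniteMeasure μ₂ := by
  have := h.moment₂ 0
  simp only [pow_zero] at this
  simpa [integrable_const_iff, isFiniteMeasure_iff] using this

lemma ae_nonneg₁ : ∀ᵐ x ∂μ₁, 0 ≤ x := by
  rw [ae_iff]; simpa [Iio] using h.nonneg₁

lemma ae_nonneg₂ : ∀ᵐ x ∂μ₂, 0 ≤ x := by
  rw [ae_iff]; simpa [Iio] using h.nonneg₂

/-- On the closed quadrant x + y vanishes only at the origin, which is null for the product because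
one of the two measures has no atom at 0. -/
lemma ae_add_pos : ∀ᵐ p ∂(μ₁.prod μ₂), 0 < p.1 + p.2 := by
  have := h.finite₁
  have := h.finite₂
  have h1 : ∀ᵐ p ∂(μ₁.prod μ₂), 0 ≤ p.1 := Measure.quasiMeasurePreserving_fst.ae h.ae_nonneg₁
  have h2 : ∀ᵐ p ∂(μ₁.prod μ₂), 0 ≤ p.2 := Measure.quasiMeasurePreserving_snd.ae h.ae_nonneg₂
  have h3 : ∀ᵐ p ∂(μ₁.prod μ₂), p ∉ ({0} : Set ℝ) ×ˢ ({0} : Set ℝ) := by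
    rw [ae_iff]
    simp only [not_not, ofPred_mem_eq, Measure.prod_prod]
    rcases h.origin with h | h <;> simp [h]
  filter_upwards [h1, h2, h3] with p h1 h2 h3
  refine lt_of_le_of_ne (add_nonneg h1 h2) fun h0 => h3 ?_
  simp only [mem_prod, mem_singleton_iff]
  constructor <;> linarith

lemma swap : AdmissiblePair μ₂ μ₁ where
  nonneg₁ := h.nonneg₂
  nonneg₂ := h.nonneg₁
  origin := h.origin.symm
  infinite₁ := h.infinite₂
  infinite₂ := h.infinite₁
  moment₁ := h.moment₂
  moment₂ := h.moment₁
  cauchyMoment i j := by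
    have := h.finite₁
    have := h.finite₂
    refine (h.cauchyMoment j i).swap.congr (Eventually.of_forall fun p => ?_)
    simp [mul_comm, add_comm]

lemma moment_swap (i j : ℕ) : moment μ₂ μ₁ i j = moment μ₁ μ₂ j i := by
  have := h.finite₁
  have := h.finite₂
  rw [moment, moment, ← integral_prod_swap]
  refine integral_congr_ae (Eventually.of_forall fun p => ?_)
  simp [mul_comm, add_comm]

lemma integral_pow_mul_pow (i j : ℕ) : ∫ p : ℝ × ℝ, p.1 ^ i * p.2 ^ j ∂(μ₁.prod μ₂) =
    singleMoment μ₁ i * singleMoment μ₂ j := by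
  have := h.finite₁
  have := h.finite₂
  exact integral_prod_mul (fun x : ℝ => x ^ i) fun y : ℝ => y ^ j

lemma integrable_pow_mul_pow (i j : ℕ) :
    Integrable (fun p : ℝ × ℝ => p.1 ^ i * p.2 ^ j) (μ₁.prod μ₂) := by
  have := h.finite₁
  have := h.finite₂
  exact (h.moment₁ i).mul_prod (h.moment₂ j)

lemma div_mul_ae (i j : ℕ) :
    (fun p : ℝ × ℝ => p.1 ^ i * p.2 ^ j / (p.1 + p.2) * (p.1 + p.2)) =ᵐ[μ₁.prod μ₂]
      fun p => p.1 ^ i * p.2 ^ j := by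
  filter_upwards [h.ae_add_pos] with p hp
  field_simp

lemma moment_add (i j : ℕ) : moment μ₁ μ₂ (i + 1) j + moment μ₁ μ₂ i (j + 1) =
    singleMoment μ₁ i * singleMoment μ₂ j := by
  rw [moment, moment, ← integral_add (h.cauchyMoment _ _) (h.cauchyMoment _ _),
    ← h.integral_pow_mul_pow, ← integral_congr_ae (h.div_mul_ae i j)]
  congr 1
  ext p
  ring

end AdmissiblePair

section

variable {U : Set ℝ} {μ₁ μ₂ : ℝ → Measure ℝ} {t : ℝ}

lemma exists_Icc_subset (hU : IsOpen U) (ht : t ∈ U) : ∃ t₀ b, t₀ < t ∧ t < b ∧ Icc t₀ b ⊆ U := by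
  obtain ⟨ε, hε, h⟩ := Metric.nhds_basis_closedBall.mem_iff.1 (hU.mem_nhds ht)
  exact ⟨t - ε, t + ε, by linarith, by linarith, by rwa [← Real.closedBall_eq_Icc]⟩

lemma hasDerivAt_singleMoment₁ (hU : IsOpen U)
    (hμ : ∀ t ∈ U, AdmissiblePair (μ₁ t) (μ₂ t)) (h₁ : EvolvesByPosition μ₁ U) (ht : t ∈ U)
    (i : ℕ) : HasDerivAt (fun s => singleMoment (μ₁ s) i) (singleMoment (μ₁ t) (i + 1)) t := by
  obtain ⟨t₀, b, h0, hb, hI⟩ := exists_Icc_subset hU ht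
  have ht₀ := hI ⟨le_rfl, (h0.trans hb).le⟩
  refine (hasDerivAt_integral_reweighted (f := fun x => x ^ i) (w := fun x => x) h0 hb
    measurable_id (hμ t₀ ht₀).ae_nonneg₁ (fun s hs => ?_) (fun s hs => (hμ s (hI hs)).moment₁ i)
    fun s hs => ?_).congr_deriv ?_
  · exact h₁.eq_withDensity (fun r hr => (hμ r hr).finite₁) hs.1
      ((Icc_subset_Icc_right hs.2).trans hI)
  · simpa only [pow_succ] using (hμ s (hI hs)).moment₁ (i + 1)
  · simp only [singleMoment, pow_succ]

/-- The product measure evolves with weight x + y, which cancels the Cauchy kernel; the remaining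
integral factorises, whence the rank one right-hand side. -/
lemma hasDerivAt_moment (hU : IsOpen U)
    (hμ : ∀ t ∈ U, AdmissiblePair (μ₁ t) (μ₂ t)) (h₁ : EvolvesByPosition μ₁ U)
    (h₂ : EvolvesByPosition μ₂ U) (ht : t ∈ U) (i j : ℕ) :
    HasDerivAt (fun s => moment (μ₁ s) (μ₂ s) i j)
      (singleMoment (μ₁ t) i * singleMoment (μ₂ t) j) t := by
  obtain ⟨t₀, b, h0, hb, hI⟩ := exists_Icc_subset hU ht
  have ht₀ := hI ⟨le_rfl, (h0.trans hb).le⟩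
  refine (hasDerivAt_integral_reweighted (μ := fun s => (μ₁ s).prod (μ₂ s))
    (f := fun p : ℝ × ℝ => p.1 ^ i * p.2 ^ j / (p.1 + p.2)) (w := fun p => p.1 + p.2) h0 hb
    (by fun_prop) ((hμ t₀ ht₀).ae_add_pos.mono fun _ h => h.le) (fun s hs => ?_)
    (fun s hs => (hμ s (hI hs)).cauchyMoment i j) fun s hs => ?_).congr_deriv ?_
  · have f1 := (hμ t₀ ht₀).finite₁
    have f2 := (hμ t₀ ht₀).finite₂
    have hs' := (Icc_subset_Icc_right hs.2).trans hI
    have e1 := h₁.eq_withDensity (fun r hr => (hμ r hr).finite₁) hs.1 hs'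
    have e2 := h₂.eq_withDensity (fun r hr => (hμ r hr).finite₂) hs.1 hs'
    have g1 : SFinite ((μ₁ t₀).withDensity fun x => ENNReal.ofReal (Real.exp ((s - t₀) * x))) := by
      rw [← e1]; have := (hμ s (hI hs)).finite₁; infer_instance
    change (μ₁ s).prod (μ₂ s) = _
    rw [e1, e2, prod_withDensity (by fun_prop) (by fun_prop)]
    congr 1
    ext p
    rw [← ENNReal.ofReal_mul (Real.exp_pos _).le, ← Real.exp_add, mul_add]
  · exact ((hμ s (hI hs)).integrable_pow_mul_pow i j).congr ((hμ s (hI hs)).div_mul_ae i j).symm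
  · rw [integral_congr_ae ((hμ t ht).div_mul_ae i j), (hμ t ht).integral_pow_mul_pow]

end

end CauchyTwoMatrix

/-! ### An Andréief formula for two families of variables coupled by a kernel. -/

namespace CauchyTwoMatrix

open Matrix Equiv

section Andreief

section Expansion

variable {ι ε : Type*} [Fintype ι] [Fintype ε] [DecidableEq ι] [DecidableEq ε]

lemma det_mul_det_mul_det_eq_sum {X Y : Type*} (f : ι → X → ℝ) (g : ι ⊕ ε → Y → ℝ)
    (K : X → Y → ℝ) (h : ε → Y → ℝ) (x : ι → X) (y : ι ⊕ ε → Y) :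
    (Matrix.of fun i j => f i (x j)).det * (Matrix.of fun a b => g a (y b)).det *
      (Matrix.of fun a b => Sum.elim (fun i => K (x i) (y b)) (fun e => h e (y b)) a).det =
    ∑ π : Perm ι, ∑ ρ : Perm (ι ⊕ ε), ∑ κ : Perm (ι ⊕ ε),
      ((Perm.sign π : ℤ) : ℝ) * ((Perm.sign κ : ℤ) : ℝ) * ((Perm.sign ρ : ℤ) : ℝ) *
      ((∏ i, f (π i) (x i)) * (∏ b, g (κ b) (y b)) *
        ((∏ i, K (x i) (y (ρ (Sum.inl i)))) * ∏ e, h e (y (ρ (Sum.inr e))))) := by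
  rw [← det_transpose (Matrix.of fun a b =>
    Sum.elim (fun i => K (x i) (y b)) (fun e => h e (y b)) a)]
  simp only [det_apply', Matrix.of_apply, transpose_apply, Fintype.prod_sum_type, Sum.elim_inl,
    Sum.elim_inr]
  rw [mul_assoc, Finset.sum_mul_sum, Finset.sum_mul]
  refine Finset.sum_congr rfl fun π _ => ?_
  rw [Finset.sum_comm, Finset.mul_sum]
  refine Finset.sum_congr rfl fun ρ _ => ?_
  rw [Finset.mul_sum]
  exact Finset.sum_congr rfl fun κ _ => by ring

/-- For fixed π and ρ, substituting κρ for κ turns the inner sum into the determinant with its ι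
rows permuted by π, and the signs cancel. All pairs (π, ρ) contribute equally, which produces the
factorials. -/
lemma sum_sign_mul_prod_eq_card_mul_det (M : ι → ι ⊕ ε → ℝ) (c : ε → ι ⊕ ε → ℝ) :
    ∑ π : Perm ι, ∑ ρ : Perm (ι ⊕ ε), ∑ κ : Perm (ι ⊕ ε),
      ((Perm.sign π : ℤ) : ℝ) * ((Perm.sign κ : ℤ) : ℝ) * ((Perm.sign ρ : ℤ) : ℝ) *
      ((∏ i, M (π i) (κ (ρ (Sum.inl i)))) * ∏ e, c e (κ (ρ (Sum.inr e)))) =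
    ((Fintype.card ι).factorial : ℝ) * ((Fintype.card (ι ⊕ ε)).factorial : ℝ) *
      (Matrix.of (Sum.elim M c)).det := by
  have key (π : Perm ι) (ρ : Perm (ι ⊕ ε)) : ∑ κ : Perm (ι ⊕ ε),
      ((Perm.sign π : ℤ) : ℝ) * ((Perm.sign κ : ℤ) : ℝ) * ((Perm.sign ρ : ℤ) : ℝ) *
      ((∏ i, M (π i) (κ (ρ (Sum.inl i)))) * ∏ e, c e (κ (ρ (Sum.inr e)))) =
      (Matrix.of (Sum.elim M c)).det := by
    have h1 := det_permute (Perm.sumCongr π (1 : Perm ε)) (Matrix.of (Sum.elim M c))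
    have h2 : ((Perm.sign (Perm.sumCongr π (1 : Perm ε)) : ℤ) : ℝ) = ((Perm.sign π : ℤ) : ℝ) := by
      simp
    have h3 : ((Perm.sign π : ℤ) : ℝ) * ((Perm.sign π : ℤ) : ℝ) = 1 := by
      rw [← Int.cast_mul, ← Units.val_mul, Int.units_mul_self]; simp
    rw [h2, ← det_transpose, det_apply', ← Equiv.sum_comp (Equiv.mulRight ρ)] at h1
    rw [← one_mul (det _), ← h3, mul_assoc, ← h1, Finset.mul_sum]
    refine Finset.sum_congr rfl fun κ _ => ?_
    simp [Fintype.prod_sum_type]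
    ring
  simp only [key]
  simp only [Finset.sum_const, Finset.card_univ, Fintype.card_perm, nsmul_eq_mul, mul_assoc]

end Expansion

variable {X Y ι ε : Type*} [MeasurableSpace X] [MeasurableSpace Y]

/-- Pairs each variable of the first family with one of the second family. -/
def pairing (X Y ι ε : Type*) [MeasurableSpace X] [MeasurableSpace Y] :
    (ι → X × Y) × (ε → Y) ≃ᵐ (ι → X) × (ι ⊕ ε → Y) :=
  ((MeasurableEquiv.arrowProdEquivProdArrow X Y ι).prodCongr (MeasurableEquiv.refl (ε → Y))).trans
    (MeasurableEquiv.prodAssoc.trans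
      ((MeasurableEquiv.refl (ι → X)).prodCongr
        (MeasurableEquiv.sumPiEquivProdPi fun _ : ι ⊕ ε => Y).symm))

variable [Fintype ι] [Fintype ε] (μ : Measure X) (ν : Measure Y) [SigmaFinite μ] [SigmaFinite ν]

lemma measurePreserving_pairing :
    MeasurePreserving (pairing X Y ι ε)
      ((Measure.pi fun _ : ι => μ.prod ν).prod (Measure.pi fun _ : ε => ν))
      ((Measure.pi fun _ : ι => μ).prod (Measure.pi fun _ : ι ⊕ ε => ν)) := by
  have h1 := (measurePreserving_arrowProdEquivProdArrow X Y ι (fun _ => μ) (fun _ => ν)).prod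
    (MeasurePreserving.id (Measure.pi fun _ : ε => ν))
  have h2 := measurePreserving_prodAssoc (Measure.pi fun _ : ι => μ) (Measure.pi fun _ : ι => ν)
    (Measure.pi fun _ : ε => ν)
  have h3 := (MeasurePreserving.id (Measure.pi fun _ : ι => μ)).prod
    (measurePreserving_sumPiEquivProdPi_symm (fun _ : ι ⊕ ε => ν))
  exact h3.comp (h2.comp h1)

variable {μ ν}

lemma integral_pairing {F : ι → X × Y → ℝ} {H : ε → Y → ℝ}
    (hF : ∀ i, Integrable (F i) (μ.prod ν)) (hH : ∀ e, Integrable (H e) ν) :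
    Integrable (fun z : (ι → X) × (ι ⊕ ε → Y) =>
        (∏ i, F i (z.1 i, z.2 (Sum.inl i))) * ∏ e, H e (z.2 (Sum.inr e)))
      ((Measure.pi fun _ : ι => μ).prod (Measure.pi fun _ : ι ⊕ ε => ν)) ∧
    ∫ z, (∏ i, F i (z.1 i, z.2 (Sum.inl i))) * ∏ e, H e (z.2 (Sum.inr e))
      ∂((Measure.pi fun _ : ι => μ).prod (Measure.pi fun _ : ι ⊕ ε => ν)) =
    (∏ i, ∫ p, F i p ∂(μ.prod ν)) * ∏ e, ∫ y, H e y ∂ν := by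
  have hp := measurePreserving_pairing (ι := ι) (ε := ε) μ ν
  constructor
  · rw [← hp.integrable_comp_emb (MeasurableEquiv.measurableEmbedding _)]
    exact (Integrable.fintype_prod hF).mul_prod (Integrable.fintype_prod hH)
  · rw [← hp.integral_comp', ← integral_fintype_prod_eq_prod, ← integral_fintype_prod_eq_prod,
      ← integral_prod_mul]
    rfl

variable {f : ι → X → ℝ} {g : ι ⊕ ε → Y → ℝ} {K : X → Y → ℝ} {h : ε → Y → ℝ}

/-- Permuting the y variables by ρ preserves the product measure and matches each kernel factor with
its own pair of variables, after which the integral is a product. -/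
lemma integral_pairing_perm
    (hF : ∀ i b, Integrable (fun p : X × Y => f i p.1 * g b p.2 * K p.1 p.2) (μ.prod ν))
    (hH : ∀ e b, Integrable (fun y => g b y * h e y) ν) (ρ : Perm (ι ⊕ ε)) :
    Integrable (fun z : (ι → X) × (ι ⊕ ε → Y) =>
        (∏ i, f i (z.1 i)) * (∏ b, g b (z.2 b)) *
          ((∏ i, K (z.1 i) (z.2 (ρ (Sum.inl i)))) * ∏ e, h e (z.2 (ρ (Sum.inr e)))))
      ((Measure.pi fun _ : ι => μ).prod (Measure.pi fun _ : ι ⊕ ε => ν)) ∧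
    ∫ z, (∏ i, f i (z.1 i)) * (∏ b, g b (z.2 b)) *
          ((∏ i, K (z.1 i) (z.2 (ρ (Sum.inl i)))) * ∏ e, h e (z.2 (ρ (Sum.inr e))))
      ∂((Measure.pi fun _ : ι => μ).prod (Measure.pi fun _ : ι ⊕ ε => ν)) =
    (∏ i, ∫ p, f i p.1 * g (ρ (Sum.inl i)) p.2 * K p.1 p.2 ∂(μ.prod ν)) *
      ∏ e, ∫ y, g (ρ (Sum.inr e)) y * h e y ∂ν := by
  let φ := (MeasurableEquiv.refl (ι → X)).prodCongr
    (MeasurableEquiv.piCongrLeft (fun _ : ι ⊕ ε => Y) ρ)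
  have hp : MeasurePreserving φ
      ((Measure.pi fun _ : ι => μ).prod (Measure.pi fun _ : ι ⊕ ε => ν))
      ((Measure.pi fun _ : ι => μ).prod (Measure.pi fun _ : ι ⊕ ε => ν)) :=
    (MeasurePreserving.id (Measure.pi fun _ : ι => μ)).prod
      (measurePreserving_piCongrLeft (fun _ : ι ⊕ ε => ν) ρ)
  have key := integral_pairing (fun i => hF i (ρ (Sum.inl i))) (fun e => hH e (ρ (Sum.inr e)))
  have e1 : ∀ z : (ι → X) × (ι ⊕ ε → Y),
      (∏ i, f i ((φ z).1 i)) * (∏ b, g b ((φ z).2 b)) *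
        ((∏ i, K ((φ z).1 i) ((φ z).2 (ρ (Sum.inl i)))) * ∏ e, h e ((φ z).2 (ρ (Sum.inr e)))) =
      (∏ i, f i (z.1 i) * g (ρ (Sum.inl i)) (z.2 (Sum.inl i)) * K (z.1 i) (z.2 (Sum.inl i))) *
        ∏ e, g (ρ (Sum.inr e)) (z.2 (Sum.inr e)) * h e (z.2 (Sum.inr e)) := by
    intro z
    have e2 (b : ι ⊕ ε) : (φ z).2 (ρ b) = z.2 b :=
      Equiv.piCongrLeft_apply_apply (fun _ : ι ⊕ ε => Y) ρ z.2 b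
    have e3 : (φ z).1 = z.1 := rfl
    rw [← Equiv.prod_comp ρ fun b => g b ((φ z).2 b), Fintype.prod_sum_type]
    simp only [e2, e3, Finset.prod_mul_distrib]
    ring
  constructor
  · rw [← hp.integrable_comp_emb (MeasurableEquiv.measurableEmbedding _)]
    exact key.1.congr (Filter.Eventually.of_forall fun z => (e1 z).symm)
  · rw [← hp.integral_comp', ← key.2]
    exact integral_congr_ae (Filter.Eventually.of_forall e1)

variable [DecidableEq ι] [DecidableEq ε]

/-- Expanding the three determinants leaves terms that factorise into double and single integrals.
The rows indexed by ε, which depend on y alone, allow more y than x variables, as σₙ requires. -/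
theorem integral_det_mul_det_mul_det
    (hF : ∀ i b, Integrable (fun p : X × Y => f i p.1 * g b p.2 * K p.1 p.2) (μ.prod ν))
    (hH : ∀ e b, Integrable (fun y => g b y * h e y) ν) :
    Integrable (fun z : (ι → X) × (ι ⊕ ε → Y) =>
      (Matrix.of fun i j => f i (z.1 j)).det * (Matrix.of fun a b => g a (z.2 b)).det *
      (Matrix.of fun a b => Sum.elim (fun i => K (z.1 i) (z.2 b)) (fun e => h e (z.2 b)) a).det)
      ((Measure.pi fun _ : ι => μ).prod (Measure.pi fun _ : ι ⊕ ε => ν)) ∧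
    ∫ z, (Matrix.of fun i j => f i (z.1 j)).det * (Matrix.of fun a b => g a (z.2 b)).det *
      (Matrix.of fun a b => Sum.elim (fun i => K (z.1 i) (z.2 b)) (fun e => h e (z.2 b)) a).det
      ∂((Measure.pi fun _ : ι => μ).prod (Measure.pi fun _ : ι ⊕ ε => ν)) =
    ((Fintype.card ι).factorial : ℝ) * ((Fintype.card (ι ⊕ ε)).factorial : ℝ) *
      (Matrix.of (Sum.elim (fun i b => ∫ p, f i p.1 * g b p.2 * K p.1 p.2 ∂(μ.prod ν))
        (fun e b => ∫ y, g b y * h e y ∂ν))).det := by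
  simp only [det_mul_det_mul_det_eq_sum]
  have key (π : Perm ι) (ρ κ : Perm (ι ⊕ ε)) := integral_pairing_perm
    (f := fun i => f (π i)) (g := fun b => g (κ b)) (K := K) (h := h)
    (fun i b => hF (π i) (κ b)) (fun e b => hH e (κ b)) ρ
  constructor
  · exact integrable_finsetSum _ fun π _ => integrable_finsetSum _ fun ρ _ =>
      integrable_finsetSum _ fun κ _ => (key π ρ κ).1.const_mul _
  · rw [← sum_sign_mul_prod_eq_card_mul_det]
    rw [integral_finsetSum _ fun π _ => integrable_finsetSum _ fun ρ _ =>
      integrable_finsetSum _ fun κ _ => (key π ρ κ).1.const_mul _]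
    refine Finset.sum_congr rfl fun π _ => ?_
    rw [integral_finsetSum _ fun ρ _ =>
      integrable_finsetSum _ fun κ _ => (key π ρ κ).1.const_mul _]
    refine Finset.sum_congr rfl fun ρ _ => ?_
    rw [integral_finsetSum _ fun κ _ => (key π ρ κ).1.const_mul _]
    refine Finset.sum_congr rfl fun κ _ => ?_
    rw [integral_const_mul, (key π ρ κ).2]

end Andreief

end CauchyTwoMatrix

namespace CauchyTwoMatrix

open Matrix

section AndreiefFin

variable {X Y : Type*} [MeasurableSpace X] [MeasurableSpace Y] {μ : Measure X} {ν : Measure Y}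
  [SigmaFinite μ] [SigmaFinite ν] {n r : ℕ} {f : Fin n → X → ℝ} {g : Fin (n + r) → Y → ℝ}
  {K : X → Y → ℝ} {h : Fin r → Y → ℝ}

theorem integral_det_mul_det_mul_det_fin
    (hF : ∀ i b, Integrable (fun p : X × Y => f i p.1 * g b p.2 * K p.1 p.2) (μ.prod ν))
    (hH : ∀ e b, Integrable (fun y => g b y * h e y) ν) :
    Integrable (fun z : (Fin n → X) × (Fin (n + r) → Y) =>
      (Matrix.of fun i j => f i (z.1 j)).det * (Matrix.of fun a b => g a (z.2 b)).det *
      (Matrix.of fun a b : Fin (n + r) =>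
        Fin.append (fun i => K (z.1 i) (z.2 b)) (fun e => h e (z.2 b)) a).det)
      ((Measure.pi fun _ : Fin n => μ).prod (Measure.pi fun _ : Fin (n + r) => ν)) ∧
    ∫ z, (Matrix.of fun i j => f i (z.1 j)).det * (Matrix.of fun a b => g a (z.2 b)).det *
      (Matrix.of fun a b : Fin (n + r) =>
        Fin.append (fun i => K (z.1 i) (z.2 b)) (fun e => h e (z.2 b)) a).det
      ∂((Measure.pi fun _ : Fin n => μ).prod (Measure.pi fun _ : Fin (n + r) => ν)) =
    (n.factorial : ℝ) * ((n + r).factorial : ℝ) *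
      (Matrix.of fun a b : Fin (n + r) =>
        Fin.append (fun i => ∫ p, f i p.1 * g b p.2 * K p.1 p.2 ∂(μ.prod ν))
        (fun e => ∫ y, g b y * h e y ∂ν) a).det := by
  let φ := (MeasurableEquiv.refl (Fin n → X)).prodCongr
    (MeasurableEquiv.piCongrLeft (fun _ : Fin (n + r) => Y) finSumFinEquiv)
  have hp : MeasurePreserving φ
      ((Measure.pi fun _ : Fin n => μ).prod (Measure.pi fun _ : Fin n ⊕ Fin r => ν))
      ((Measure.pi fun _ : Fin n => μ).prod (Measure.pi fun _ : Fin (n + r) => ν)) :=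
    (MeasurePreserving.id (Measure.pi fun _ : Fin n => μ)).prod
      (measurePreserving_piCongrLeft (fun _ : Fin (n + r) => ν) finSumFinEquiv)
  have key := integral_det_mul_det_mul_det (f := f) (g := fun b => g (finSumFinEquiv b)) (K := K)
    (h := h) (fun i b => hF i _) (fun e b => hH e _)
  have e1 : ∀ z : (Fin n → X) × (Fin n ⊕ Fin r → Y),
      (Matrix.of fun i j => f i ((φ z).1 j)).det * (Matrix.of fun a b => g a ((φ z).2 b)).det *
      (Matrix.of fun a b : Fin (n + r) =>
        Fin.append (fun i => K ((φ z).1 i) ((φ z).2 b)) (fun e => h e ((φ z).2 b)) a).det =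
      (Matrix.of fun i j => f i (z.1 j)).det *
      (Matrix.of fun a b => g (finSumFinEquiv a) (z.2 b)).det *
      (Matrix.of fun a b => Sum.elim (fun i => K (z.1 i) (z.2 b)) (fun e => h e (z.2 b)) a).det := by
    intro z
    have e2 (b : Fin n ⊕ Fin r) : (φ z).2 (finSumFinEquiv b) = z.2 b :=
      Equiv.piCongrLeft_apply_apply (fun _ : Fin (n + r) => Y) finSumFinEquiv z.2 b
    have e3 : (φ z).1 = z.1 := rfl
    rw [← det_submatrix_equiv_self finSumFinEquiv (Matrix.of fun a b => g a ((φ z).2 b)),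
      ← det_submatrix_equiv_self finSumFinEquiv (Matrix.of fun a b : Fin (n + r) =>
        Fin.append (fun i => K ((φ z).1 i) ((φ z).2 b)) (fun e => h e ((φ z).2 b)) a)]
    congr 2
    · congr 1
      ext a b
      simp only [submatrix_apply, Matrix.of_apply, e2]
    · ext a b
      simp only [submatrix_apply, Matrix.of_apply, e2, e3]
      rcases a with a | a <;> simp
  have e4 : (Matrix.of fun a b : Fin (n + r) =>
        Fin.append (fun i => ∫ p, f i p.1 * g b p.2 * K p.1 p.2 ∂(μ.prod ν))
        (fun e => ∫ y, g b y * h e y ∂ν) a).det =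
      (Matrix.of (Sum.elim
        (fun i b => ∫ p, f i p.1 * g (finSumFinEquiv b) p.2 * K p.1 p.2 ∂(μ.prod ν))
        (fun e b => ∫ y, g (finSumFinEquiv b) y * h e y ∂ν))).det := by
    rw [← det_submatrix_equiv_self finSumFinEquiv]
    congr 1
    ext a b
    rcases a with a | a <;> simp
  constructor
  · rw [← hp.integrable_comp_emb (MeasurableEquiv.measurableEmbedding _)]
    exact key.1.congr (Filter.Eventually.of_forall fun z => (e1 z).symm)
  · rw [← hp.integral_comp', e4]
    refine (integral_congr_ae (Filter.Eventually.of_forall e1)).trans (key.2.trans ?_)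
    simp

end AndreiefFin

/-! ### Cauchy and Vandermonde determinants. -/

section Cauchy

lemma det_eq_corner_mul_det {n : ℕ} (A : Matrix (Fin (n + 1)) (Fin (n + 1)) ℝ)
    (hd : A (Fin.last n) (Fin.last n) ≠ 0) :
    A.det = A (Fin.last n) (Fin.last n) * (Matrix.of fun i j : Fin n =>
      A i.castSucc j.castSucc - A i.castSucc (Fin.last n) * A (Fin.last n) j.castSucc /
        A (Fin.last n) (Fin.last n)).det := by
  set d := A (Fin.last n) (Fin.last n) with hd'
  let D : Matrix (Fin 1) (Fin 1) ℝ := Matrix.of fun _ _ => d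
  have hD : D.det = d := by simp [D]
  let _ := D.invertibleOfIsUnitDet (by rw [hD]; exact isUnit_iff_ne_zero.2 hd)
  have hDi : ⅟D = Matrix.of fun _ _ => d⁻¹ := by
    refine invOf_eq_right_inv ?_
    ext i j
    rw [Subsingleton.elim i j]
    simp [Matrix.mul_apply, D, hd]
  have h := det_snoc_corner (Matrix.of fun i j : Fin n => A i.castSucc j.castSucc)
    (fun i => A i.castSucc (Fin.last n)) (fun j => A (Fin.last n) j.castSucc) d
  have h2 := det_fromBlocks₂₂ (Matrix.of fun i j : Fin n => A i.castSucc j.castSucc)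
    (Matrix.replicateCol (Fin 1) fun i => A i.castSucc (Fin.last n))
    (Matrix.replicateRow (Fin 1) fun j => A (Fin.last n) j.castSucc) D
  rw [hDi, hD] at h2
  calc A.det = _ := by
        congr 1
        ext i j
        refine Fin.lastCases ?_ (fun i => ?_) i <;> refine Fin.lastCases ?_ (fun j => ?_) j
        all_goals simp [hd']
    _ = _ := h
    _ = _ := h2
    _ = _ := by
        congr 2
        ext i j
        simp [Matrix.mul_apply]
        ring

lemma vandermondeProd_castSucc {n : ℕ} (z : Fin (n + 1) → ℝ) :
    vandermondeProd z = vandermondeProd (fun i : Fin n => z i.castSucc) *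
      ∏ i : Fin n, (z (Fin.last n) - z i.castSucc) := by
  simp only [vandermondeProd, ← Finset.filter_lt_eq_Ioi, Finset.prod_filter,
    Fin.prod_univ_castSucc]
  simp [Finset.prod_mul_distrib, Fin.castSucc_lt_last, (Fin.le_last _).not_gt]

lemma vandermondeProd_eq_det {n : ℕ} (z : Fin n → ℝ) :
    vandermondeProd z = (Matrix.of fun i j : Fin n => z j ^ (i : ℕ)).det := by
  rw [vandermondeProd, ← det_vandermonde, ← det_transpose]
  rfl

/-- Eliminating the last row and column leaves the smaller Cauchy matrix with its rows and columns
rescaled; the scaling factors are the new factors of the product formula. -/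
theorem det_cauchy {n : ℕ} (x y : Fin n → ℝ) (h : ∀ i j, x i + y j ≠ 0) :
    (Matrix.of fun i j => 1 / (x i + y j)).det =
      vandermondeProd x * vandermondeProd y / ∏ i, ∏ j, (x i + y j) := by
  induction n with
  | zero => simp [vandermondeProd]
  | succ n ih =>
    set X := x (Fin.last n) with hX
    set Y := y (Fin.last n) with hY
    have hc : X + Y ≠ 0 := h _ _
    have ih' := ih (fun i => x i.castSucc) (fun j => y j.castSucc) fun i j => h _ _
    have e : (Matrix.of fun i j : Fin n => 1 / (x i.castSucc + y j.castSucc) -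
        1 / (x i.castSucc + Y) * (1 / (X + y j.castSucc)) / (1 / (X + Y))) =
        Matrix.of fun i j : Fin n => ((X - x i.castSucc) / (x i.castSucc + Y)) *
          (Matrix.of fun i j : Fin n => ((Y - y j.castSucc) / (X + y j.castSucc)) *
            (Matrix.of fun i j : Fin n => 1 / (x i.castSucc + y j.castSucc)) i j) i j := by
      ext i j
      have h1 := h i.castSucc j.castSucc
      have h2 : x i.castSucc + Y ≠ 0 := h _ _
      have h3 : X + y j.castSucc ≠ 0 := h _ _
      simp only [Matrix.of_apply]
      field_simp
      ring
    rw [det_eq_corner_mul_det _ (by simpa using hc)]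
    simp only [Matrix.of_apply, ← hX, ← hY]
    rw [e, det_mul_column, det_mul_row, ih', vandermondeProd_castSucc x,
      vandermondeProd_castSucc y]
    simp only [Fin.prod_univ_castSucc, Finset.prod_mul_distrib, Finset.prod_div_distrib, ← hX,
      ← hY]
    have p1 : ∏ i : Fin n, (x i.castSucc + Y) ≠ 0 := Finset.prod_ne_zero_iff.2 fun i _ => h _ _
    have p2 : ∏ i : Fin n, (X + y i.castSucc) ≠ 0 := Finset.prod_ne_zero_iff.2 fun i _ => h _ _
    have p3 : ∏ i : Fin n, ∏ j : Fin n, (x i.castSucc + y j.castSucc) ≠ 0 :=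
      Finset.prod_ne_zero_iff.2 fun i _ => Finset.prod_ne_zero_iff.2 fun j _ => h _ _
    field_simp

/-- Eliminating with the corner entry 1 again leaves a rescaled Cauchy matrix, now of square size n.
-/
theorem det_cauchy_snoc_one {n : ℕ} (x : Fin n → ℝ) (y : Fin (n + 1) → ℝ)
    (h : ∀ i j, x i + y j ≠ 0) :
    (Matrix.of fun i j : Fin (n + 1) =>
      (Fin.snoc (fun i => 1 / (x i + y j)) 1 : Fin (n + 1) → ℝ) i).det =
      vandermondeProd x * vandermondeProd y / ∏ i, ∏ j, (x i + y j) := by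
  set Y := y (Fin.last n) with hY
  have e : (Matrix.of fun i j : Fin n => 1 / (x i + y j.castSucc) - 1 / (x i + Y)) =
        Matrix.of fun i j : Fin n => (1 / (x i + Y)) *
          (Matrix.of fun i j : Fin n => (Y - y j.castSucc) *
            (Matrix.of fun i j : Fin n => 1 / (x i + y j.castSucc)) i j) i j := by
    ext i j
    have h1 := h i j.castSucc
    have h2 : x i + Y ≠ 0 := h _ _
    simp only [Matrix.of_apply]
    field_simp
    ring
  rw [det_eq_corner_mul_det _ (by simp)]
  simp only [Matrix.of_apply, Fin.snoc_last, Fin.snoc_castSucc, ← hY, div_one, mul_one, one_mul]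
  rw [e, det_mul_column, det_mul_row, det_cauchy x _ fun i j => h _ _, vandermondeProd_castSucc y]
  simp only [Fin.prod_univ_castSucc, Finset.prod_mul_distrib, Finset.prod_div_distrib, ← hY,
    Finset.prod_const_one]
  have p1 : ∏ i : Fin n, (x i + Y) ≠ 0 := Finset.prod_ne_zero_iff.2 fun i _ => h _ _
  have p3 : ∏ i : Fin n, ∏ j : Fin n, (x i + y j.castSucc) ≠ 0 :=
    Finset.prod_ne_zero_iff.2 fun i _ => Finset.prod_ne_zero_iff.2 fun j _ => h _ _
  field_simp

/-- The derivative of the Vandermonde determinant along the shift of exponents is computed twice: by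
rows only the last shift survives, and by columns the k-th term is xₖ times the determinant. -/
lemma det_pow_skipIndex {n : ℕ} (hn : 1 ≤ n) (x : Fin n → ℝ) :
    (Matrix.of fun i j : Fin n => x j ^ skipIndex n i).det = vandermondeProd x * ∑ j, x j := by
  obtain ⟨n, rfl⟩ := Nat.exists_eq_add_of_le' hn
  have h1 := detDeriv_shift fun i (j : Fin (n + 1)) => x j ^ i
  rw [detDeriv_eq_sum_updateCol] at h1
  have h2 (k : Fin (n + 1)) : ((Matrix.of fun (i : Fin (n + 1)) (j : Fin (n + 1)) =>
      x j ^ (i : ℕ)).updateCol k fun i => x k ^ ((i : ℕ) + 1)).det =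
      x k * vandermondeProd x := by
    rw [vandermondeProd_eq_det, show (fun i : Fin (n + 1) => x k ^ ((i : ℕ) + 1)) =
      x k • fun i : Fin (n + 1) => (Matrix.of fun (i : Fin (n + 1)) (j : Fin (n + 1)) =>
      x j ^ (i : ℕ)) i k by ext i; simp [pow_succ, mul_comm], det_updateCol_smul,
      updateCol_eq_self]
  rw [mul_comm, Finset.sum_mul, ← Finset.sum_congr rfl fun k _ => h2 k]
  refine Eq.trans ?_ h1.symm
  congr 1
  ext i j
  refine Fin.lastCases ?_ (fun i => ?_) i
  · simp [skipIndex]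
  · simp [skipIndex, i.2.ne]

end Cauchy

end CauchyTwoMatrix

/-! ### Convergence and determinant formulas of the tau functions. -/

namespace CauchyTwoMatrix

open Matrix Set Filter

section Density

lemma density_swap (p q : ℕ) (z : (Fin p → ℝ) × (Fin q → ℝ)) :
    density q p z.swap = density p q z := by
  simp only [density, Prod.fst_swap, Prod.snd_swap]
  rw [Finset.prod_comm, mul_comm (vandermondeProd z.2 ^ 2)]
  simp only [add_comm]

lemma density_nonneg {p q : ℕ} {z : (Fin p → ℝ) × (Fin q → ℝ)} (h : ∀ i j, 0 < z.1 i + z.2 j) :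
    0 ≤ density p q z :=
  div_nonneg (by positivity)
    (Finset.prod_nonneg fun i _ => Finset.prod_nonneg fun j _ => (h i j).le)

lemma density_ne_zero {p q : ℕ} {z : (Fin p → ℝ) × (Fin q → ℝ)} (h : ∀ i j, 0 < z.1 i + z.2 j)
    (h1 : Function.Injective z.1) (h2 : Function.Injective z.2) : density p q z ≠ 0 := by
  refine div_ne_zero (mul_ne_zero (pow_ne_zero _ ?_) (pow_ne_zero _ ?_))
    (Finset.prod_ne_zero_iff.2 fun i _ => Finset.prod_ne_zero_iff.2 fun j _ => (h i j).ne')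
  · rw [vandermondeProd, ← det_vandermonde]
    exact det_vandermonde_ne_zero_iff.2 h1
  · rw [vandermondeProd, ← det_vandermonde]
    exact det_vandermonde_ne_zero_iff.2 h2

lemma density_eq_det {n : ℕ} {z : (Fin n → ℝ) × (Fin n → ℝ)} (h : ∀ i j, 0 < z.1 i + z.2 j) :
    density n n z = vandermondeProd z.1 * vandermondeProd z.2 *
      (Matrix.of fun i j => 1 / (z.1 i + z.2 j)).det := by
  rw [det_cauchy _ _ fun i j => (h i j).ne', density]
  ring

lemma density_succ_eq_det {n : ℕ} {z : (Fin n → ℝ) × (Fin (n + 1) → ℝ)}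
    (h : ∀ i j, 0 < z.1 i + z.2 j) :
    density n (n + 1) z = vandermondeProd z.1 * vandermondeProd z.2 *
      (Matrix.of fun i j : Fin (n + 1) =>
        (Fin.snoc (fun i => 1 / (z.1 i + z.2 j)) 1 : Fin (n + 1) → ℝ) i).det := by
  rw [det_cauchy_snoc_one _ _ fun i j => (h i j).ne', density]
  ring

end Density

namespace AdmissiblePair

variable {μ₁ μ₂ : Measure ℝ} (h : AdmissiblePair μ₁ μ₂)
include h

lemma ae_pos (p q : ℕ) : ∀ᵐ z ∂(productMeasure μ₁ μ₂ p q), ∀ i j, 0 < z.1 i + z.2 j := by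
  have := h.finite₁
  have := h.finite₂
  rw [ae_all_iff]
  intro i
  rw [ae_all_iff]
  intro j
  have h1 := QuasiMeasurePreserving.prodMap
    (Measure.quasiMeasurePreserving_eval (fun _ : Fin p => μ₁) i)
    (Measure.quasiMeasurePreserving_eval (fun _ : Fin q => μ₂) j)
  exact h1.ae h.ae_add_pos

lemma integrable_comp_swap {p q : ℕ} {F : (Fin p → ℝ) × (Fin q → ℝ) → ℝ} :
    Integrable (fun z => F z.swap) (productMeasure μ₂ μ₁ q p) ↔
      Integrable F (productMeasure μ₁ μ₂ p q) := by
  have := h.finite₁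
  have := h.finite₂
  exact integrable_swap_iff

lemma integral_comp_swap {p q : ℕ} (F : (Fin p → ℝ) × (Fin q → ℝ) → ℝ) :
    ∫ z, F z.swap ∂(productMeasure μ₂ μ₁ q p) = ∫ z, F z ∂(productMeasure μ₁ μ₂ p q) := by
  have := h.finite₁
  have := h.finite₂
  exact integral_prod_swap F

lemma tau_swap (n : ℕ) : tau μ₂ μ₁ n = tau μ₁ μ₂ n := by
  rw [tau, tau, ← h.integral_comp_swap]
  simp only [density_swap]

lemma sigma_swap (n : ℕ) : sigma μ₂ μ₁ n = sigmaHat μ₁ μ₂ n := by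
  rw [sigma, sigmaHat, ← h.integral_comp_swap]
  simp only [density_swap]

lemma xi_swap (n : ℕ) : xi μ₂ μ₁ n = xiHat μ₁ μ₂ n := by
  rw [xi, xiHat, ← h.integral_comp_swap]
  simp only [density_swap, Prod.snd_swap]

/-- Arbitrary exponents are allowed so that τ and ξ come from the same formula. -/
lemma integral_det_pow {n : ℕ} (α β : Fin n → ℕ) :
    Integrable (fun z : (Fin n → ℝ) × (Fin n → ℝ) =>
      (Matrix.of fun i j => z.1 j ^ α i).det * (Matrix.of fun i j => z.2 j ^ β i).det *
        (Matrix.of fun i j => 1 / (z.1 i + z.2 j)).det) (productMeasure μ₁ μ₂ n n) ∧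
    ∫ z, (Matrix.of fun i j => z.1 j ^ α i).det * (Matrix.of fun i j => z.2 j ^ β i).det *
        (Matrix.of fun i j => 1 / (z.1 i + z.2 j)).det ∂(productMeasure μ₁ μ₂ n n) =
      (n.factorial : ℝ) ^ 2 * (Matrix.of fun i j => moment μ₁ μ₂ (α i) (β j)).det := by
  have := h.finite₁
  have := h.finite₂
  have key := integral_det_mul_det_mul_det_fin (μ := μ₁) (ν := μ₂) (n := n) (r := 0)
    (f := fun i x => x ^ α i) (g := fun j y => y ^ β j) (K := fun x y => 1 / (x + y))
    (h := fun _ _ => 1)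
    (fun i b => (h.cauchyMoment (α i) (β b)).congr (Eventually.of_forall fun p => by
      simp [div_eq_mul_inv])) (fun e => e.elim0)
  have e1 (u : Fin n → ℝ) (v : Fin 0 → ℝ) : Fin.append u v = u := by
    rw [Subsingleton.elim v Fin.elim0, Fin.append_elim0]
    rfl
  simp only [e1, mul_one_div] at key
  rw [sq]
  simp only [one_div] at key ⊢
  exact key

lemma integral_det_pow_succ {n : ℕ} (α : Fin n → ℕ) (β : Fin (n + 1) → ℕ) :
    Integrable (fun z : (Fin n → ℝ) × (Fin (n + 1) → ℝ) =>
      (Matrix.of fun i j => z.1 j ^ α i).det * (Matrix.of fun i j => z.2 j ^ β i).det *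
        (Matrix.of fun i j : Fin (n + 1) =>
          (Fin.snoc (fun i => 1 / (z.1 i + z.2 j)) 1 : Fin (n + 1) → ℝ) i).det)
      (productMeasure μ₁ μ₂ n (n + 1)) ∧
    ∫ z, (Matrix.of fun i j => z.1 j ^ α i).det * (Matrix.of fun i j => z.2 j ^ β i).det *
        (Matrix.of fun i j : Fin (n + 1) =>
          (Fin.snoc (fun i => 1 / (z.1 i + z.2 j)) 1 : Fin (n + 1) → ℝ) i).det
        ∂(productMeasure μ₁ μ₂ n (n + 1)) =
      (n.factorial : ℝ) * ((n + 1).factorial : ℝ) * (Matrix.of fun i j : Fin (n + 1) =>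
        (Fin.snoc (fun i => moment μ₁ μ₂ (α i) (β j)) (singleMoment μ₂ (β j)) :
          Fin (n + 1) → ℝ) i).det := by
  have := h.finite₁
  have := h.finite₂
  have key := integral_det_mul_det_mul_det_fin (μ := μ₁) (ν := μ₂) (n := n) (r := 1)
    (f := fun i x => x ^ α i) (g := fun j y => y ^ β j) (K := fun x y => 1 / (x + y))
    (h := fun _ _ => 1)
    (fun i b => (h.cauchyMoment (α i) (β b)).congr (Eventually.of_forall fun p => by
      simp [div_eq_mul_inv])) (fun e b => by simpa using h.moment₂ (β b))
  simp only [Fin.append_right_eq_snoc, mul_one_div] at key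
  simp only [mul_one] at key
  exact key

lemma tau_integral (n : ℕ) : Integrable (density n n) (productMeasure μ₁ μ₂ n n) ∧
    tau μ₁ μ₂ n = (Matrix.of fun i j : Fin n => moment μ₁ μ₂ i j).det := by
  have key := h.integral_det_pow (fun i : Fin n => (i : ℕ)) (fun i => (i : ℕ))
  have e : density n n =ᵐ[productMeasure μ₁ μ₂ n n] _ := (h.ae_pos n n).mono fun z hz => by
    rw [density_eq_det hz, vandermondeProd_eq_det, vandermondeProd_eq_det]
  refine ⟨key.1.congr e.symm, ?_⟩
  rw [tau, integral_congr_ae e, key.2]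
  have := Nat.factorial_pos n
  field_simp

lemma xi_integral (n : ℕ) :
    Integrable (fun z => density n n z * ∑ j, z.1 j) (productMeasure μ₁ μ₂ n n) ∧
    (1 ≤ n → xi μ₁ μ₂ n = (Matrix.of fun i j : Fin n => moment μ₁ μ₂ (skipIndex n i) j).det) := by
  rcases Nat.eq_zero_or_pos n with rfl | hn
  · simp
  have key := h.integral_det_pow (skipIndex n) (fun i => (i : ℕ))
  have e : (fun z => density n n z * ∑ j, z.1 j) =ᵐ[productMeasure μ₁ μ₂ n n] fun z =>
      (Matrix.of fun i j => z.1 j ^ skipIndex n i).det *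
        (Matrix.of fun i j : Fin n => z.2 j ^ (i : ℕ)).det *
        (Matrix.of fun i j => 1 / (z.1 i + z.2 j)).det :=
    (h.ae_pos n n).mono fun z hz => by
      dsimp only
      rw [density_eq_det hz, det_pow_skipIndex hn, ← vandermondeProd_eq_det z.2]
      ring
  refine ⟨key.1.congr e.symm, fun _ => ?_⟩
  rw [xi, integral_congr_ae e, key.2]
  have := Nat.factorial_pos n
  field_simp

lemma sigma_integral (n : ℕ) :
    Integrable (density n (n + 1)) (productMeasure μ₁ μ₂ n (n + 1)) ∧
    sigma μ₁ μ₂ n = (Matrix.of fun i j : Fin (n + 1) =>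
      if (i : ℕ) < n then moment μ₁ μ₂ i j else singleMoment μ₂ j).det := by
  have key := h.integral_det_pow_succ (fun i : Fin n => (i : ℕ)) (fun i => (i : ℕ))
  have e : density n (n + 1) =ᵐ[productMeasure μ₁ μ₂ n (n + 1)] _ :=
    (h.ae_pos n (n + 1)).mono fun z hz => by
      rw [density_succ_eq_det hz, vandermondeProd_eq_det, vandermondeProd_eq_det]
  refine ⟨key.1.congr e.symm, ?_⟩
  rw [sigma, integral_congr_ae e, key.2]
  have := Nat.factorial_pos n
  have := Nat.factorial_pos (n + 1)
  rw [← mul_assoc, one_div, inv_mul_cancel₀ (by positivity), one_mul]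
  refine congrArg Matrix.det ?_
  ext i j
  refine Fin.lastCases ?_ (fun i => ?_) i <;> simp

lemma tauIntegrable (n : ℕ) : TauIntegrable μ₁ μ₂ n where
  tau := (h.tau_integral n).1
  sigma := (h.sigma_integral n).1
  sigmaHat := by
    rw [← h.integrable_comp_swap]
    simpa only [density_swap] using (h.swap.sigma_integral n).1
  xi := (h.xi_integral n).1
  xiHat := by
    rw [← h.integrable_comp_swap]
    simpa only [density_swap, Prod.snd_swap] using (h.swap.xi_integral n).1

lemma tauDeterminants (n : ℕ) : TauDeterminants μ₁ μ₂ n where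
  tau := (h.tau_integral n).2
  sigma := (h.sigma_integral n).2
  sigmaHat := by
    rw [← h.sigma_swap, (h.swap.sigma_integral n).2, ← det_transpose]
    congr 1
    ext i j
    simp [h.moment_swap]
  xi := (h.xi_integral n).2
  xiHat hn := by
    rw [← h.xi_swap, (h.swap.xi_integral n).2 hn, ← det_transpose]
    congr 1
    ext i j
    simp [h.moment_swap]
  xi_zero := by simp [CauchyTwoMatrix.xi]
  xiHat_zero := by simp [CauchyTwoMatrix.xiHat]

end AdmissiblePair

/-! ### Positivity, and the tau functions as minors of the bordered array. -/

section Positivity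

/-- The complement of the support is null, so the support is infinite even without 0. The sets are
disjoint neighbourhoods of n positive support points; avoiding 0 keeps x + y positive on them. -/
lemma exists_disjoint_pos_measure {μ : Measure ℝ} (h0 : μ (Iio 0) = 0)
    (hinf : ∀ S : Set ℝ, S.Finite → μ Sᶜ ≠ 0) (n : ℕ) :
    ∃ V : Fin n → Set ℝ, (∀ i, 0 < μ (V i)) ∧ (∀ i, V i ⊆ Ioi 0) ∧
      Pairwise (Function.onFun Disjoint V) := by
  have hs : (μ.support \ {0}).Infinite := by
    intro hfin
    refine hinf _ ((hfin.union (finite_singleton 0)).subset ?_) Measure.measure_compl_support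
    intro x hx
    by_cases h : x = 0
    · exact Or.inr h
    · exact Or.inl ⟨hx, h⟩
  let c : Fin n → ℝ := fun i => hs.natEmbedding _ i
  have hc : Function.Injective c := fun i j hij =>
    Fin.ext ((hs.natEmbedding _).injective (Subtype.ext hij))
  obtain ⟨V, hV, hd⟩ := (finite_range c).t2_separation
  have hpos (i : Fin n) : c i ∈ Ioi (0 : ℝ) := by
    have hm : c i ∈ μ.support \ {0} := (hs.natEmbedding _ i).2
    refine lt_of_le_of_ne (not_lt.1 fun hlt => ?_) (Ne.symm hm.2)
    exact Measure.subset_compl_support_of_isOpen isOpen_Iio h0 hlt hm.1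
  refine ⟨fun i => V (c i) ∩ Ioi 0, fun i => ?_, fun i => inter_subset_right, fun i j hij => ?_⟩
  · have hm : c i ∈ μ.support := (hs.natEmbedding _ i).2.1
    exact (Measure.mem_support_iff_forall _).1 hm _
      (((hV _).2.inter isOpen_Ioi).mem_nhds ⟨(hV _).1, hpos i⟩)
  · exact (hd (mem_range_self i) (mem_range_self j) (hc.ne hij)).mono inter_subset_left
      inter_subset_left

lemma injective_of_mem_disjoint {n : ℕ} {V : Fin n → Set ℝ}
    (hd : Pairwise (Function.onFun Disjoint V)) {x : Fin n → ℝ} (hx : ∀ i, x i ∈ V i) :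
    Function.Injective x := fun i j hij => by
  by_contra hne
  exact Set.disjoint_left.1 (hd hne) (hx i) (hij ▸ hx j)

lemma AdmissiblePair.integral_density_pos {μ₁ μ₂ : Measure ℝ} (h : AdmissiblePair μ₁ μ₂)
    {p q : ℕ} (hi : Integrable (density p q) (productMeasure μ₁ μ₂ p q)) :
    0 < ∫ z, density p q z ∂(productMeasure μ₁ μ₂ p q) := by
  have := h.finite₁
  have := h.finite₂
  rw [integral_pos_iff_support_of_nonneg_ae
    ((h.ae_pos p q).mono fun z hz => density_nonneg hz) hi]
  obtain ⟨V, hV, hV0, hVd⟩ := exists_disjoint_pos_measure h.nonneg₁ h.infinite₁ p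
  obtain ⟨W, hW, hW0, hWd⟩ := exists_disjoint_pos_measure h.nonneg₂ h.infinite₂ q
  refine lt_of_lt_of_le (b := productMeasure μ₁ μ₂ p q (Set.pi univ V ×ˢ Set.pi univ W)) ?_
    (measure_mono ?_)
  · rw [productMeasure, Measure.prod_prod, Measure.pi_pi, Measure.pi_pi]
    exact ENNReal.mul_pos (Finset.prod_ne_zero_iff.2 fun i _ => (hV i).ne')
      (Finset.prod_ne_zero_iff.2 fun i _ => (hW i).ne')
  · rintro z ⟨h1, h2⟩
    have h1' : ∀ i, z.1 i ∈ V i := fun i => h1 i (mem_univ i)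
    have h2' : ∀ i, z.2 i ∈ W i := fun i => h2 i (mem_univ i)
    exact density_ne_zero (fun i j => add_pos (hV0 i (h1' i)) (hW0 j (h2' j)))
      (injective_of_mem_disjoint hVd h1') (injective_of_mem_disjoint hWd h2')

namespace AdmissiblePair

variable {μ₁ μ₂ : Measure ℝ} (h : AdmissiblePair μ₁ μ₂)
include h

lemma tau_pos (n : ℕ) : 0 < tau μ₁ μ₂ n :=
  mul_pos (by positivity) (h.integral_density_pos (h.tauIntegrable n).tau)

lemma sigma_pos (n : ℕ) : 0 < sigma μ₁ μ₂ n :=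
  mul_pos (by positivity) (h.integral_density_pos (h.tauIntegrable n).sigma)

lemma sigmaHat_pos (n : ℕ) : 0 < sigmaHat μ₁ μ₂ n :=
  mul_pos (by positivity) (h.integral_density_pos (h.tauIntegrable n).sigmaHat)

lemma tau_eq_tauDet (n : ℕ) :
    tau μ₁ μ₂ n = tauDet (moment μ₁ μ₂) (singleMoment μ₁) (singleMoment μ₂) n :=
  (h.tauDeterminants n).tau

lemma sigma_eq_sigmaDet (n : ℕ) :
    sigma μ₁ μ₂ n = sigmaDet (moment μ₁ μ₂) (singleMoment μ₁) (singleMoment μ₂) n := by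
  rw [(h.tauDeterminants n).sigma, sigmaDet, minor]
  congr 1
  ext i j
  refine Fin.lastCases ?_ (fun i => ?_) i <;> simp [bordered, idx]

lemma xi_eq_xiDet (n : ℕ) :
    xi μ₁ μ₂ n = xiDet (moment μ₁ μ₂) (singleMoment μ₁) (singleMoment μ₂) n := by
  rcases n with _ | n
  · exact (h.tauDeterminants 0).xi_zero
  rw [(h.tauDeterminants (n + 1)).xi (by omega), xiDet, minor]
  congr 1
  ext i j
  refine Fin.lastCases ?_ (fun i => ?_) i
  · simp [bordered, idx, skipIndex]
  · simp [bordered, idx, skipIndex, i.2.ne]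

lemma moment_swap' : moment μ₂ μ₁ = fun i j => moment μ₁ μ₂ j i := by
  funext i j
  exact h.moment_swap i j

lemma sigmaHat_eq_sigmaDet (n : ℕ) : sigmaHat μ₁ μ₂ n =
    sigmaDet (fun i j => moment μ₁ μ₂ j i) (singleMoment μ₂) (singleMoment μ₁) n := by
  rw [← h.sigma_swap, h.swap.sigma_eq_sigmaDet, h.moment_swap']

lemma xiHat_eq_xiDet (n : ℕ) : xiHat μ₁ μ₂ n =
    xiDet (fun i j => moment μ₁ μ₂ j i) (singleMoment μ₂) (singleMoment μ₁) n := by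
  rw [← h.xi_swap, h.swap.xi_eq_xiDet, h.moment_swap']

end AdmissiblePair

end Positivity

/-! ### The bilinear flow of the tau functions. -/

section Flow

variable {U : Set ℝ} {μ₁ μ₂ : ℝ → Measure ℝ} {t : ℝ}

theorem tauFlow (hU : IsOpen U) (hμ : ∀ t ∈ U, AdmissiblePair (μ₁ t) (μ₂ t))
    (h₁ : EvolvesByPosition μ₁ U) (h₂ : EvolvesByPosition μ₂ U) (ht : t ∈ U) :
    TauFlow (fun n s => tau (μ₁ s) (μ₂ s) n) (fun n s => xi (μ₁ s) (μ₂ s) n)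
      (fun n s => xiHat (μ₁ s) (μ₂ s) n) (fun n s => sigma (μ₁ s) (μ₂ s) n)
      (fun n s => sigmaHat (μ₁ s) (μ₂ s) n) t := by
  have h := hμ t ht
  have hm := h.moment_add
  have dm := hasDerivAt_moment hU hμ h₁ h₂ ht
  have db := hasDerivAt_singleMoment₁ hU (fun s hs => (hμ s hs).swap) h₂ ht
  -- The integrals agree with the determinants on all of U, which is a neighbourhood of t, so
  -- derivatives carry over.
  have loc {F G : ℝ → ℝ} {d : ℝ} (hFG : ∀ s ∈ U, F s = G s) (hG : HasDerivAt G d t) :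
      HasDerivAt F d t :=
    hG.congr_of_eventuallyEq (mem_of_superset (hU.mem_nhds ht) hFG)
  have hne (n : ℕ) : tauDet (moment (μ₁ t) (μ₂ t)) (singleMoment (μ₁ t)) (singleMoment (μ₂ t)) n
      ≠ 0 := by
    rw [← h.tau_eq_tauDet]
    exact (h.tau_pos n).ne'
  have dsigma (n : ℕ) := loc (fun s hs => (hμ s hs).sigma_eq_sigmaDet n)
    (hasDerivAt_sigmaDet (a := fun s => singleMoment (μ₁ s)) hm dm db n)
  refine
    { tau_zero := ?_
      xi_zero := h.tauDeterminants 0 |>.xi_zero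
      tau_ne := fun n => (h.tau_pos n).ne'
      sigma_ne := fun n => (h.sigma_pos n).ne'
      sigmaHat_ne := fun n => (h.sigmaHat_pos n).ne'
      deriv_tau := fun n => ?_
      wronskian := fun n => ?_
      deriv_xi_zero := ?_
      deriv_xi := fun n => ?_
      deriv_sigma_zero := ⟨_, dsigma 0, ?_⟩
      deriv_sigma := fun n => ⟨_, _, dsigma (n + 1), ?_, ?_⟩ }
  · rw [h.tau_eq_tauDet, tauDet_zero]
  · simp only [h.xi_eq_xiDet, h.xiHat_eq_xiDet]
    exact loc (fun s hs => (hμ s hs).tau_eq_tauDet n) (hasDerivAt_tauDet hm dm n)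
  · simp only [h.xi_eq_xiDet, h.xiHat_eq_xiDet, h.tau_eq_tauDet, h.sigma_eq_sigmaDet,
      h.sigmaHat_eq_sigmaDet]
    exact tau_wronskian hm (hne n)
  · exact loc (fun s hs => (hμ s hs).tauDeterminants 0 |>.xi_zero) (hasDerivAt_const t 0)
  · refine ⟨_, loc (fun s hs => (hμ s hs).xi_eq_xiDet (n + 1))
      (hasDerivAt_xiDet (a := fun s => singleMoment (μ₁ s)) (b := fun s => singleMoment (μ₂ s))
        dm n), ?_⟩
    simp only [h.xi_eq_xiDet, h.xiHat_eq_xiDet, h.tau_eq_tauDet, h.sigma_eq_sigmaDet,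
      h.sigmaHat_eq_sigmaDet]
    exact xi_wronskian hm (hne n)
  · simp only [h.xiHat_eq_xiDet, h.tau_eq_tauDet, h.sigma_eq_sigmaDet]
    exact sigma_shift_col (hne 0)
  · simp only [h.xiHat_eq_xiDet, h.tau_eq_tauDet, h.sigma_eq_sigmaDet]
    exact sigma_shift_col (hne (n + 1))
  · simp only [h.xi_eq_xiDet, h.tau_eq_tauDet, h.sigma_eq_sigmaDet]
    exact sigma_shift_row (hne n)

theorem tauFlow_swap (hU : IsOpen U) (hμ : ∀ t ∈ U, AdmissiblePair (μ₁ t) (μ₂ t))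
    (h₁ : EvolvesByPosition μ₁ U) (h₂ : EvolvesByPosition μ₂ U) (ht : t ∈ U) :
    TauFlow (fun n s => tau (μ₁ s) (μ₂ s) n) (fun n s => xiHat (μ₁ s) (μ₂ s) n)
      (fun n s => xi (μ₁ s) (μ₂ s) n) (fun n s => sigmaHat (μ₁ s) (μ₂ s) n)
      (fun n s => sigma (μ₁ s) (μ₂ s) n) t := by
  have h := tauFlow hU (fun s hs => (hμ s hs).swap) h₂ h₁ ht
  have loc {F G : ℝ → ℝ} (hFG : ∀ s ∈ U, F s = G s) : F =ᶠ[nhds t] G :=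
    mem_of_superset (hU.mem_nhds ht) hFG
  exact h.congr (fun n => loc fun s hs => ((hμ s hs).tau_swap n).symm)
    (fun n => loc fun s hs => ((hμ s hs).xi_swap n).symm)
    (fun n => loc fun s hs => (hμ s hs).swap.xi_swap n)
    (fun n => loc fun s hs => ((hμ s hs).sigma_swap n).symm)
    (fun n => loc fun s hs => (hμ s hs).swap.sigma_swap n)

end Flow

end CauchyTwoMatrix

theorem mainTheorem3 (U : Set ℝ) (hU : IsOpen U) (μ₁ μ₂ : ℝ → Measure ℝ)
    (hμ : ∀ t ∈ U, CauchyTwoMatrix.AdmissiblePair (μ₁ t) (μ₂ t))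
    (h₁ : CauchyTwoMatrix.EvolvesByPosition μ₁ U)
    (h₂ : CauchyTwoMatrix.EvolvesByPosition μ₂ U) :
    (∀ t ∈ U, ∀ n : ℕ,
      CauchyTwoMatrix.TauIntegrable (μ₁ t) (μ₂ t) n ∧
      CauchyTwoMatrix.TauDeterminants (μ₁ t) (μ₂ t) n ∧
      0 < CauchyTwoMatrix.tau (μ₁ t) (μ₂ t) n ∧
      0 < CauchyTwoMatrix.sigma (μ₁ t) (μ₂ t) n ∧
      0 < CauchyTwoMatrix.sigmaHat (μ₁ t) (μ₂ t) n) ∧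
    CauchyTwoMatrix.IsLatticeSolution U
      (fun n t => CauchyTwoMatrix.A (μ₁ t) (μ₂ t) n)
      (fun n t => CauchyTwoMatrix.B (μ₁ t) (μ₂ t) n)
      (fun n t => CauchyTwoMatrix.BHat (μ₁ t) (μ₂ t) n)
      (fun n t => CauchyTwoMatrix.C (μ₁ t) (μ₂ t) n)
      (fun n t => CauchyTwoMatrix.CHat (μ₁ t) (μ₂ t) n) := by
  refine ⟨fun t ht n => ?_, CauchyTwoMatrix.isLatticeSolution_of_tauFlow
    (fun t ht => CauchyTwoMatrix.tauFlow hU hμ h₁ h₂ ht)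
    fun t ht => CauchyTwoMatrix.tauFlow_swap hU hμ h₁ h₂ ht⟩
  have h := hμ t ht
  exact ⟨h.tauIntegrable n, h.tauDeterminants n, h.tau_pos n, h.sigma_pos n, h.sigmaHat_pos n⟩
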